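/- Let $d\ge 1$, let $\Omega\subset\mathbb{R}^d$ be a bounded Lipschitz domain, let $s\in(0,1)$ with $s\neq\frac12$, and let $c_{d,s}=\frac{s\,2^{2s}\,\Gamma(s+d/2)}{\pi^{d/2}\,\Gamma(1-s)}$. For $\Omega'=\Omega$ or $\Omega'=\mathbb{R}^d$ let $H^s(\Omega')$ be the space of all $u\in L^2(\Omega')$ with finite norm belonging to the inner product $$(u,v)_{H^s(\Omega')}=\int_{\Omega'}uv\,dx+\frac{c_{d,s}}{2}\int_{\Omega'}\int_{\Omega'}\frac{(u(x)-u(y))(v(x)-v(y))}{|x-y|^{d+2s}}\,dy\,dx .$$ Let $W$ be one of the following Hilbert spaces of functions on $\Omega$: 1. $H^s_0(\Omega)$, the closure of $C_c^\infty(\Omega)$ in $H^s(\Omega)$, with the inner product of $H^s(\Omega)$; 2. $\tilde H^s(\Omega)=\{u\in H^s(\mathbb{R}^d): u=0 \text{ a.e. in } \mathbb{R}^d\setminus\Omega\}$, with the inner product of $H^s(\mathbb{R}^d)$; 3. the spectral space $\mathbb{H}^s(\Omega)=\{w=\sum_n w_n\phi_n\in L^2(\Omega): \sum_n\lambda_n^s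 w_n^2<\infty\}$, $w_n=\int_\Omega w\phi_n\,dx$, with inner product $\sum_n\lambda_n^s u_nv_n$, where $(\phi_n)$ are the $L^2(\Omega)$-orthonormal eigenfunctions of $-\Delta$ on $\Omega$ with zero Dirichlet boundary conditions and $\lambda_n$ are their eigenvalues. Let $F:W\to\mathbb{R}$ be weakly (sequentially) lower semicontinuous, continuously Fréchet differentiable and bounded from below by a continuous affine function, and let $\alpha,\beta>0$. Let $\bar w_0\in W$ be a local minimizer, with respect to the norm of $W$, of $$w\mapsto F(w)+\frac{\alpha}{2}\|w\|_W^2+\beta\int_\Omega|w|^0\,dx,\qquad 0^0:=0,$$ so that $\int_\Omega|w|^0dx$ is the Lebesgue measure of $\{x\in\Omega: w(x)\neq0\}$. Then there is exactly one $\bar\lambda_0\in W^*$ with $$\langle F'(\bar w_0),v\rangle_W+\alpha(\bar w_0,v)_W+\beta\langle\bar\lambda_0,v\rangle_W=0\qquad\text{for all } v\in W,$$ and it satisfies $$\langle\bar\lambda_0,\bar w_0\rangle_W\ge0 .$$ Moreover, for every $\varphi\in C_c^\infty(\Omega)$ with $\varphi\ge0$, the product $\varphi\bar w_0$ belongs to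 $W$ and $$\langle\bar\lambda_0,\varphi\bar w_0\rangle_W\ge0 .$$ -/

import Mathlib

open MeasureTheory Set Filter
open scoped ContDiff Topology RealInnerProductSpace

noncomputable section

namespace FracSob

/-- Euclidean space `ℝ^d`. -/
abbrev E (d : ℕ) : Type := EuclideanSpace ℝ (Fin d)

/-- The real Hilbert space `L²(Ω)`. -/
abbrev L2 {d : ℕ} (Ω : Set (E d)) : Type := Lp ℝ 2 ((volume : Measure (E d)).restrict Ω)

/-- Vector fields on `Ω` with components in `L²(Ω)`. -/
abbrev L2Vec {d : ℕ} (Ω : Set (E d)) : Type := Lp (E d) 2 ((volume : Measure (E d)).restrict Ω)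

/-- Bounded Lipschitz domains: bounded open sets which, near every boundary point and in suitable
Cartesian coordinates, are the strict epigraph of a Lipschitz function of the coordinates orthogonal
to a unit vector `n`. Connectedness is not required. -/
structure IsBoundedLipschitzDomain {d : ℕ} (Ω : Set (E d)) : Prop where
  isOpen : IsOpen Ω
  isBounded : Bornology.IsBounded Ω
  lipschitz_boundary : ∀ z ∈ frontier Ω, ∃ r > 0, ∃ n : E d, ‖n‖ = 1 ∧
    ∃ (K : NNReal) (g : E d → ℝ), LipschitzWith K g ∧
      ∀ x ∈ Metric.ball z r, x ∈ Ω ↔ g (x - ⟪n, x⟫ • n) < ⟪n, x⟫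

/-- `φ ∈ C_c^∞(Ω)`, as a function on `ℝ^d` that vanishes outside its compact support in `Ω`. -/
structure IsTestFunction {d : ℕ} (Ω : Set (E d)) (φ : E d → ℝ) : Prop where
  smooth : ContDiff ℝ ∞ φ
  compact : HasCompactSupport φ
  support_subset : tsupport φ ⊆ Ω

/-! ### Integral fractional Sobolev spaces -/

/-- The constant `c_{d,s}`. -/
def fracConst (d : ℕ) (s : ℝ) : ℝ :=
  s * (2 : ℝ) ^ (2 * s) * Real.Gamma (s + d / 2) / (Real.pi ^ ((d : ℝ) / 2) * Real.Gamma (1 - s))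

/-- The measure `(c_{d,s} / 2) |x - y|^{-(d + 2s)} dx dy` on `Ω × Ω`. -/
def gagliardo {d : ℕ} (Ω : Set (E d)) (s : ℝ) : Measure (E d × E d) :=
  (((volume : Measure (E d)).restrict Ω).prod ((volume : Measure (E d)).restrict Ω)).withDensity
    fun p => ENNReal.ofReal (fracConst d s / 2 / ‖p.1 - p.2‖ ^ ((d : ℝ) + 2 * s))

theorem ae_gagliardo_of_ae {d : ℕ} {Ω : Set (E d)} (s : ℝ) {P : E d → Prop}
    (h : ∀ᵐ x ∂((volume : Measure (E d)).restrict Ω), P x) :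
    ∀ᵐ p ∂(gagliardo Ω s), P p.1 ∧ P p.2 := by
  refine (withDensity_absolutelyContinuous _ _).ae_le ?_
  exact (Measure.quasiMeasurePreserving_fst.ae h).and (Measure.quasiMeasurePreserving_snd.ae h)

/-- The space `H^s(Ω)`. An element is a pair `(u, U)` with `u ∈ L²(Ω)`, `U(x, y) = u(x) - u(y)`, and
`U` square integrable for the measure `(c_{d,s} / 2) |x - y|^{-(d + 2s)} dx dy` on `Ω × Ω`;
`U` is determined by `u`. The inner product inherited from the Hilbert sum is
`∫_Ω u v dx + (c_{d,s} / 2) ∫_Ω ∫_Ω (u(x) - u(y)) (v(x) - v(y)) / |x - y|^{d + 2s} dy dx`. -/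
def Hs {d : ℕ} (Ω : Set (E d)) (s : ℝ) :
    Submodule ℝ (WithLp 2 (L2 Ω × Lp ℝ 2 (gagliardo Ω s))) where
  carrier := {p | ∀ᵐ z ∂(gagliardo Ω s), p.snd z = p.fst z.1 - p.fst z.2}
  zero_mem' := by
    filter_upwards [Lp.coeFn_zero ℝ 2 (gagliardo Ω s), ae_gagliardo_of_ae s
      (Lp.coeFn_zero ℝ 2 ((volume : Measure (E d)).restrict Ω))] with z h1 h2
    change (0 : Lp ℝ 2 (gagliardo Ω s)) z = (0 : L2 Ω) z.1 - (0 : L2 Ω) z.2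
    rw [h1, h2.1, h2.2]
    simp
  add_mem' := by
    intro p q hp hq
    filter_upwards [hp, hq, Lp.coeFn_add p.snd q.snd,
      ae_gagliardo_of_ae s (Lp.coeFn_add p.fst q.fst)] with z h1 h2 h3 h4
    simp only [WithLp.add_fst, WithLp.add_snd]
    rw [h3, h4.1, h4.2]
    simp only [Pi.add_apply, h1, h2]
    ring
  smul_mem' := by
    intro c p hp
    filter_upwards [hp, Lp.coeFn_smul c p.snd,
      ae_gagliardo_of_ae s (Lp.coeFn_smul c p.fst)] with z h1 h3 h4
    simp only [WithLp.smul_fst, WithLp.smul_snd]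
    rw [h3, h4.1, h4.2]
    simp only [Pi.smul_apply, h1, smul_eq_mul]
    ring

/-- `H_0^s(Ω)`, the closure of `C_c^∞(Ω)` in `H^s(Ω)`, with the inner product of `H^s(Ω)`. -/
def H0s {d : ℕ} (Ω : Set (E d)) (s : ℝ) : Submodule ℝ (Hs Ω s) :=
  (Submodule.span ℝ {u : Hs Ω s | ∃ φ : E d → ℝ, IsTestFunction Ω φ ∧
    u.1.fst =ᵐ[(volume : Measure (E d)).restrict Ω] φ}).topologicalClosure

/-- The space of all `u ∈ H^s(ℝ^d)` that vanish almost everywhere outside `Ω`, with the inner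
product of `H^s(ℝ^d)`. -/
def HTilde {d : ℕ} (Ω : Set (E d)) (s : ℝ) : Submodule ℝ (Hs (univ : Set (E d)) s) where
  carrier := {u | ∀ᵐ x ∂((volume : Measure (E d)).restrict univ), x ∉ Ω → u.1.fst x = 0}
  zero_mem' := by
    filter_upwards [Lp.coeFn_zero ℝ 2 ((volume : Measure (E d)).restrict univ)] with x h _
    exact h
  add_mem' := by
    intro u v hu hv
    filter_upwards [hu, hv, Lp.coeFn_add u.1.fst v.1.fst] with x h1 h2 h3 hx
    have : (u + v).1.fst = u.1.fst + v.1.fst := rfl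
    rw [this, h3, Pi.add_apply, h1 hx, h2 hx, add_zero]
  smul_mem' := by
    intro c u hu
    filter_upwards [hu, Lp.coeFn_smul c u.1.fst] with x h1 h3 hx
    have : (c • u).1.fst = c • u.1.fst := rfl
    rw [this, h3, Pi.smul_apply, h1 hx, smul_zero]

/-! ### The spectral fractional Sobolev space -/

/-- `H_0^1(Ω)`, as the closure of the pairs `(φ, ∇φ)`, `φ ∈ C_c^∞(Ω)`, in `L²(Ω) × L²(Ω)^d`: its
elements are the pairs `(u, ∇u)`. -/
def H10 {d : ℕ} (Ω : Set (E d)) : Submodule ℝ (WithLp 2 (L2 Ω × L2Vec Ω)) :=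
  (Submodule.span ℝ {p : WithLp 2 (L2 Ω × L2Vec Ω) | ∃ φ : E d → ℝ, IsTestFunction Ω φ ∧
    p.fst =ᵐ[(volume : Measure (E d)).restrict Ω] φ ∧
    p.snd =ᵐ[(volume : Measure (E d)).restrict Ω] gradient φ}).topologicalClosure

/-- `u ≠ 0` is an eigenfunction of `-Δ` on `Ω` with zero Dirichlet boundary conditions, in the weak
sense, for the (necessarily positive) eigenvalue `μ`: `u ∈ H_0^1(Ω)` and
`∫_Ω ∇u · ∇v dx = μ ∫_Ω u v dx` for all `v ∈ H_0^1(Ω)`. -/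
def IsDirichletEigenfunction {d : ℕ} (Ω : Set (E d)) (μ : ℝ) (u : L2 Ω) : Prop :=
  u ≠ 0 ∧ 0 < μ ∧ ∃ p ∈ H10 Ω, p.fst = u ∧ ∀ q ∈ H10 Ω, ⟪p.snd, q.snd⟫ = μ * ⟪p.fst, q.fst⟫

/-- The orthonormal Dirichlet eigenfunctions `φ_n` of a domain with their eigenvalues, repeated
according to multiplicity. That the list is exhaustive is expressed by maximality: no eigenfunction
is orthogonal to all the `φ_n`. -/
structure DirichletEigensystem {d : ℕ} (Ω : Set (E d)) (ι : Type) where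
  fn : ι → L2 Ω
  ev : ι → ℝ
  orthonormal : Orthonormal ℝ fn
  eigen : ∀ n, IsDirichletEigenfunction Ω (ev n) (fn n)
  maximal : ∀ μ u, IsDirichletEigenfunction Ω μ u → ∃ n, ⟪fn n, u⟫ ≠ 0

/-- A (maximal) eigensystem exists. -/
theorem exists_dirichletEigensystem {d : ℕ} (Ω : Set (E d)) :
    ∃ ι : Type, Nonempty (DirichletEigensystem Ω ι) := by
  obtain ⟨A, hA⟩ := zorn_subset
    {A : Set (L2 Ω) | Orthonormal ℝ ((↑) : A → L2 Ω) ∧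
      ∀ u ∈ A, ∃ μ, IsDirichletEigenfunction Ω μ u} (by
    intro c hc hchain
    refine ⟨⋃₀ c, ⟨orthonormal_sUnion_of_directed hchain.directedOn fun a ha => (hc ha).1, ?_⟩,
      fun a ha => subset_sUnion_of_mem ha⟩
    rintro u ⟨a, ha, hu⟩
    exact (hc ha).2 u hu)
  choose ev hev using fun n : A => hA.prop.2 n n.2
  refine ⟨A, ⟨⟨fun n => n, ev, hA.prop.1, hev, ?_⟩⟩⟩
  rintro μ u ⟨hu0, hμ, p, hp, hpu, hpq⟩
  by_contra! hperp
  have hn : ‖u‖ ≠ 0 := norm_ne_zero_iff.2 hu0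
  set e : L2 Ω := ‖u‖⁻¹ • u with he
  have he1 : ‖e‖ = 1 := by rw [he, norm_smul, norm_inv, norm_norm, inv_mul_cancel₀ hn]
  have heA : ∀ v ∈ A, ⟪v, e⟫ = 0 := fun v hv => by
    rw [he, inner_smul_right, hperp ⟨v, hv⟩, mul_zero]
  have hins : insert e A ∈ {A : Set (L2 Ω) | Orthonormal ℝ ((↑) : A → L2 Ω) ∧
      ∀ u ∈ A, ∃ μ, IsDirichletEigenfunction Ω μ u} := by
    refine ⟨⟨?_, ?_⟩, ?_⟩
    · rintro ⟨v, rfl | hv⟩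
      · exact he1
      · exact hA.prop.1.1 ⟨v, hv⟩
    · rintro ⟨v, rfl | hv⟩ ⟨w, rfl | hw⟩ hvw
      · exact absurd rfl hvw
      · exact (real_inner_comm _ _).trans (heA w hw)
      · exact heA v hv
      · exact hA.prop.1.2 (i := ⟨v, hv⟩) (j := ⟨w, hw⟩) fun h =>
          hvw (Subtype.ext (congrArg Subtype.val h :))
    · rintro v (rfl | hv)
      · refine ⟨μ, smul_ne_zero (inv_ne_zero hn) hu0, hμ, ‖u‖⁻¹ • p,
          (H10 Ω).smul_mem _ hp, by rw [WithLp.smul_fst, hpu], fun q hq => ?_⟩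
        rw [WithLp.smul_fst, WithLp.smul_snd, inner_smul_left, inner_smul_left, hpq q hq]
        ring
      · exact hA.prop.2 v hv
  have heq := heA e (hA.le_of_ge hins (subset_insert e A) (mem_insert e A))
  rw [real_inner_self_eq_norm_sq, he1] at heq
  norm_num at heq

/-- The functions `w = ∑ₙ wₙ φ_n ∈ L²(Ω)`, `wₙ = ∫_Ω w φ_n dx`, with `∑ₙ λ_n^s wₙ² < ∞`. -/
def specSubmodule {d : ℕ} {Ω : Set (E d)} {ι : Type} (S : DirichletEigensystem Ω ι) (s : ℝ) :
    Submodule ℝ (L2 Ω) where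
  carrier := {w | HasSum (fun n => ⟪S.fn n, w⟫ • S.fn n) w ∧
    Summable fun n => S.ev n ^ s * ⟪S.fn n, w⟫ ^ 2}
  zero_mem' := by simp [hasSum_zero, summable_zero]
  add_mem' := by
    rintro u v ⟨hu, hu'⟩ ⟨hv, hv'⟩
    refine ⟨by simpa only [inner_add_right, add_smul] using hu.add hv, ?_⟩
    refine Summable.of_nonneg_of_le (fun n => ?_) (fun n => ?_)
      ((hu'.mul_left 2).add (hv'.mul_left 2))
    · have := Real.rpow_nonneg (S.eigen n).2.1.le s
      positivity
    · have := Real.rpow_nonneg (S.eigen n).2.1.le s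
      rw [inner_add_right]
      nlinarith [mul_nonneg this (sq_nonneg (⟪S.fn n, u⟫ - ⟪S.fn n, v⟫))]
  smul_mem' := by
    rintro c u ⟨hu, hu'⟩
    refine ⟨by simpa only [inner_smul_right, mul_smul, RCLike.ofReal_real_eq_id, id_eq]
      using hu.const_smul c, ?_⟩
    refine (hu'.mul_left (c ^ 2)).congr fun n => ?_
    simp only [inner_smul_right]
    ring

/-- The spectral fractional Sobolev space, with inner product `∑ₙ λ_n^s uₙ vₙ`. -/
def HSpec {d : ℕ} {Ω : Set (E d)} {ι : Type} (S : DirichletEigensystem Ω ι) (s : ℝ) : Type :=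
  specSubmodule S s

namespace HSpec

variable {d : ℕ} {Ω : Set (E d)} {ι : Type} (S : DirichletEigensystem Ω ι) (s : ℝ)

instance : AddCommGroup (HSpec S s) := inferInstanceAs (AddCommGroup (specSubmodule S s))

instance : Module ℝ (HSpec S s) := inferInstanceAs (Module ℝ (specSubmodule S s))

/-- The underlying function in `L²(Ω)`. -/
def toL2 : HSpec S s →ₗ[ℝ] L2 Ω := (specSubmodule S s).subtype

theorem summable_inner (u v : HSpec S s) :
    Summable fun n => S.ev n ^ s * (⟪S.fn n, toL2 S s u⟫ * ⟪S.fn n, toL2 S s v⟫) := by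
  have hu : Summable fun n => S.ev n ^ s * ⟪S.fn n, toL2 S s u⟫ ^ 2 := u.2.2
  have hv : Summable fun n => S.ev n ^ s * ⟪S.fn n, toL2 S s v⟫ ^ 2 := v.2.2
  refine Summable.of_norm_bounded (hu.add hv) fun n => ?_
  have h := Real.rpow_nonneg (S.eigen n).2.1.le s
  rw [Real.norm_eq_abs, abs_mul, abs_of_nonneg h, ← mul_add]
  refine mul_le_mul_of_nonneg_left ?_ h
  rw [abs_le]
  constructor <;> nlinarith [sq_nonneg (⟪S.fn n, toL2 S s u⟫ - ⟪S.fn n, toL2 S s v⟫),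
    sq_nonneg (⟪S.fn n, toL2 S s u⟫ + ⟪S.fn n, toL2 S s v⟫),
    sq_nonneg ⟪S.fn n, toL2 S s u⟫, sq_nonneg ⟪S.fn n, toL2 S s v⟫]

/-- The inner product of the spectral fractional Sobolev space. -/
@[reducible]
def core : InnerProductSpace.Core ℝ (HSpec S s) where
  inner u v := ∑' n, S.ev n ^ s * (⟪S.fn n, toL2 S s u⟫ * ⟪S.fn n, toL2 S s v⟫)
  conj_inner_symm u v := by
    simp only [conj_trivial]
    exact tsum_congr fun n => by ring
  re_inner_nonneg u := by
    simp only [RCLike.re_to_real]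
    exact tsum_nonneg fun n =>
      mul_nonneg (Real.rpow_nonneg (S.eigen n).2.1.le s) (mul_self_nonneg _)
  add_left u v w := by
    rw [← (summable_inner S s u w).tsum_add (summable_inner S s v w)]
    exact tsum_congr fun n => by
      rw [map_add, inner_add_right]
      ring
  smul_left u v c := by
    simp only [conj_trivial]
    rw [← tsum_mul_left]
    exact tsum_congr fun n => by
      rw [map_smul, inner_smul_right]
      ring
  definite u hu := by
    have h0 := (hasSum_zero_iff_of_nonneg (fun n =>
      mul_nonneg (Real.rpow_nonneg (S.eigen n).2.1.le s) (mul_self_nonneg _))).1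
      (hu ▸ (summable_inner S s u u).hasSum)
    have h1 : ∀ n, ⟪S.fn n, toL2 S s u⟫ = 0 := fun n => by
      have := congrFun h0 n
      simpa [(Real.rpow_pos_of_pos (S.eigen n).2.1 s).ne'] using this
    have h2 : HasSum (fun n => ⟪S.fn n, toL2 S s u⟫ • S.fn n) (toL2 S s u) := u.2.1
    simp only [h1, zero_smul] at h2
    exact Subtype.ext (h2.unique hasSum_zero)

instance : NormedAddCommGroup (HSpec S s) := (core S s).toNormedAddCommGroup

instance : InnerProductSpace ℝ (HSpec S s) := InnerProductSpace.ofCore (core S s).toCore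

end HSpec

/-! ### The Hilbert space `W` -/

/-- The admissible choices of the inner product of `W`: that of `H^s(Ω)`, that of `H^s(ℝ^d)`
(for functions extended by zero), or the spectral one. -/
inductive InnerChoice {d : ℕ} (Ω : Set (E d)) : Type 1
  | integral : InnerChoice Ω
  | global : InnerChoice Ω
  | spectral (ι : Type) (S : DirichletEigensystem Ω ι) : InnerChoice Ω

/-- The space `W`: one of `H_0^s(Ω)`, `H̃^s(Ω)`, `ℍ^s(Ω)` with its own inner product. -/
def W {d : ℕ} {Ω : Set (E d)} (s : ℝ) : InnerChoice Ω → Type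
  | .integral => H0s Ω s
  | .global => HTilde Ω s
  | .spectral _ S => HSpec S s

namespace W

variable {d : ℕ} {Ω : Set (E d)} (s : ℝ)

instance : (k : InnerChoice Ω) → NormedAddCommGroup (W s k)
  | .integral => inferInstanceAs (NormedAddCommGroup (H0s Ω s))
  | .global => inferInstanceAs (NormedAddCommGroup (HTilde Ω s))
  | .spectral _ S => inferInstanceAs (NormedAddCommGroup (HSpec S s))

instance : (k : InnerChoice Ω) → InnerProductSpace ℝ (W s k)
  | .integral => inferInstanceAs (InnerProductSpace ℝ (H0s Ω s))
  | .global => inferInstanceAs (InnerProductSpace ℝ (HTilde Ω s))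
  | .spectral _ S => inferInstanceAs (InnerProductSpace ℝ (HSpec S s))

/-- A function representing an element of `W`; only its values on `Ω`, up to null sets, matter. -/
def toFun {s : ℝ} : {k : InnerChoice Ω} → W s k → E d → ℝ
  | .integral => fun w : H0s Ω s => w.1.1.fst
  | .global => fun w : HTilde Ω s => w.1.1.fst
  | .spectral _ S => fun w : HSpec S s => HSpec.toL2 S s w

end W

/-! ### The optimization problem -/

/-- Sequential weak lower semicontinuity: `F w ≤ liminf F (u k)` whenever `u k ⇀ w`. -/
def WeaklyLSC {V : Type} [NormedAddCommGroup V] [InnerProductSpace ℝ V] (F : V → ℝ) : Prop :=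
  ∀ (u : ℕ → V) (w : V), (∀ g : V →L[ℝ] ℝ, Tendsto (fun k => g (u k)) atTop (𝓝 (g w))) →
    ∀ c < F w, ∀ᶠ k in atTop, c < F (u k)

/-- The standing assumptions on `F`. -/
structure Admissible {V : Type} [NormedAddCommGroup V] [InnerProductSpace ℝ V] (F : V → ℝ) :
    Prop where
  weaklyLSC : WeaklyLSC F
  affine_bound : ∃ (g : V →L[ℝ] ℝ) (c : ℝ), ∀ w, g w + c ≤ F w
  contDiff : ContDiff ℝ 1 F

/-- `|t|^0` with the convention `0^0 = 0`. -/
def absPowZero (t : ℝ) : ℝ := if t = 0 then 0 else 1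

/-- The objective `F(w) + (α/2) ‖w‖_W² + β ∫_Ω |w|^0 dx`. -/
def objective {d : ℕ} {Ω : Set (E d)} {s : ℝ} {k : InnerChoice Ω} (F : W s k → ℝ) (α β : ℝ)
    (w : W s k) : ℝ :=
  F w + α / 2 * ‖w‖ ^ 2 + β * ∫ x in Ω, absPowZero (w.toFun x)

/-- The equation `⟨F'(w), v⟩ + α (w, v)_W + β ⟨lam, v⟩ = 0` for all `v ∈ W`, defining the
multiplier `lam ∈ W*`. -/
def IsMultiplier {V : Type} [NormedAddCommGroup V] [InnerProductSpace ℝ V] (F : V → ℝ) (α β : ℝ)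
    (w : V) (lam : V →L[ℝ] ℝ) : Prop :=
  ∀ v : V, fderiv ℝ F w v + α * ⟪w, v⟫ + β * lam v = 0

end FracSob

end

/-!
Let `w₀` be a local minimizer and `g` a bounded function with `g w₀ ∈ W`. For small `t` the
function `w₀ + t g w₀ = (1 + t g) w₀` has the same support as `w₀`, so along this line the
discontinuous part of the objective is constant and the differentiable remainder has a local
minimum at `t = 0`. Hence every multiplier vanishes on `g w₀`, and what is left is that test
functions multiply `W` into itself.

For the two integral spaces, `φ u` is handled by the Leibniz splitting of its difference
quotient: the commutator `(φ x - φ y) u y` is controlled by the integrability of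
`min (A ^ 2) (L ^ 2 |z| ^ 2) |z| ^ (-d - 2 s)`.

The spectral space is an interpolation space between `L²(Ω)` and `H¹₀(Ω)`, both of which are
preserved by multiplication with `φ`: up to a constant, `λ ^ s` is the integral of
`t ^ (s - 1) λ / (t + λ)` over `t > 0`, and `∑ t λₙ / (t + λₙ) uₙ ^ 2` is the minimum of
`t ‖u₀‖ ^ 2 + ‖∇u₁‖ ^ 2` over all splittings `u = u₀ + u₁` with `u₁ ∈ H¹₀(Ω)`.
That the product is again the sum of its eigenfunction series requires completeness of the
eigenfunctions, which follows from Rellich's compact embedding.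
-/

noncomputable section

namespace FracSob

/-! ### Operators between `L²` spaces -/

section LpOperators

variable {α β F G H : Type*} [MeasurableSpace α] [MeasurableSpace β] [NormedAddCommGroup F]
  {μ : Measure α} {ν : Measure β}

theorem eLpNorm_two_sq (f : α → F) : eLpNorm f 2 μ ^ 2 = ∫⁻ x, ‖f x‖ₑ ^ 2 ∂μ := by
  simpa using eLpNorm_nnreal_pow_eq_lintegral (f := f) (μ := μ) (p := 2) two_ne_zero

theorem Lp_enorm_two_sq (f : Lp F 2 μ) : ‖f‖ₑ ^ 2 = ∫⁻ x, ‖f x‖ₑ ^ 2 ∂μ := by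
  rw [Lp.enorm_def, eLpNorm_two_sq]

variable [NormedSpace ℝ F]

theorem exists_weightedComposition_Lp {p : ENNReal} [Fact (1 ≤ p)] {b : β → ℝ} {π : β → α}
    (hb : AEStronglyMeasurable b ν) (hπ : Measure.QuasiMeasurePreserving π ν μ) {K : NNReal}
    (hK : ∀ f : α → F, StronglyMeasurable f →
      eLpNorm (fun z => b z • f (π z)) p ν ≤ K * eLpNorm f p μ) :
    ∃ A : Lp F p μ →L[ℝ] Lp F p ν, ∀ f, A f =ᵐ[ν] fun z => b z • f (π z) := by
  have mem (f : Lp F p μ) : MemLp (fun z => b z • f (π z)) p ν :=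
    ⟨hb.smul ((Lp.aestronglyMeasurable f).comp_quasiMeasurePreserving hπ),
      (hK f (Lp.stronglyMeasurable f)).trans_lt
        (ENNReal.mul_lt_top ENNReal.coe_lt_top (Lp.memLp f).2)⟩
  let A₀ : Lp F p μ →ₗ[ℝ] Lp F p ν :=
    { toFun f := (mem f).toLp _
      map_add' f g := by
        rw [← MemLp.toLp_add]
        refine MemLp.toLp_congr _ _ ?_
        filter_upwards [hπ.ae (Lp.coeFn_add f g)] with z hz
        simp only [hz, Pi.add_apply, smul_add]
      map_smul' c f := by
        rw [RingHom.id_apply, ← MemLp.toLp_const_smul]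
        refine MemLp.toLp_congr _ _ ?_
        filter_upwards [hπ.ae (Lp.coeFn_smul c f)] with z hz
        simp only [hz, Pi.smul_apply, smul_comm (b z) c] }
  refine ⟨A₀.mkContinuous K fun f => ?_, fun f => (mem f).coeFn_toLp⟩
  change ‖(mem f).toLp _‖ ≤ _
  rw [Lp.norm_toLp, Lp.norm_def, ← ENNReal.coe_toReal, ← ENNReal.toReal_mul]
  exact ENNReal.toReal_mono (ENNReal.mul_ne_top ENNReal.coe_ne_top (Lp.eLpNorm_ne_top f))
    (hK f (Lp.stronglyMeasurable f))

variable [NormedAddCommGroup G] [NormedSpace ℝ G] [NormedAddCommGroup H] [NormedSpace ℝ H]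

/-- The operator `g ↦ B(b(·), g(·))` on `L²` given by a bounded function `b` and a continuous
bilinear map `B`. -/
def mulLp (B : F →L[ℝ] G →L[ℝ] H) {b : α → F} (hb : MemLp b ⊤ μ) : Lp G 2 μ →L[ℝ] Lp H 2 μ :=
  B.holderL μ ⊤ 2 2 (hb.toLp b)

theorem coeFn_mulLp (B : F →L[ℝ] G →L[ℝ] H) {b : α → F} (hb : MemLp b ⊤ μ) (g : Lp G 2 μ) :
    mulLp B hb g =ᵐ[μ] fun x => B (b x) (g x) := by
  filter_upwards [B.coeFn_holder (r := 2) (hb.toLp b) g, hb.coeFn_toLp] with x hx hbx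
  rw [mulLp, ContinuousLinearMap.holderL_apply_apply, hx, hbx]

end LpOperators

section Leibniz

variable {X Y : Type*} [NormedAddCommGroup X] [NormedSpace ℝ X] [NormedAddCommGroup Y]
  [NormedSpace ℝ Y]

/-- The operator `(u, U) ↦ (A u, B U + D u)`. With `A` and `B` multiplications by `φ`, this is how
`φ` acts on pairs consisting of a function and its difference quotient or gradient; `D` is then the
remainder term of the Leibniz rule. -/
def leibnizMap (A : X →L[ℝ] X) (B : Y →L[ℝ] Y) (D : X →L[ℝ] Y) :
    WithLp 2 (X × Y) →L[ℝ] WithLp 2 (X × Y) :=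
  (WithLp.prodContinuousLinearEquiv 2 ℝ X Y).symm.toContinuousLinearMap ∘L
    ((A ∘L WithLp.fstL 2 ℝ X Y).prod (B ∘L WithLp.sndL 2 ℝ X Y + D ∘L WithLp.fstL 2 ℝ X Y))

variable (A : X →L[ℝ] X) (B : Y →L[ℝ] Y) (D : X →L[ℝ] Y) (p : WithLp 2 (X × Y))

theorem leibnizMap_fst : (leibnizMap A B D p).fst = A p.fst := rfl

theorem leibnizMap_snd : (leibnizMap A B D p).snd = B p.snd + D p.fst := rfl

theorem map_mem_topologicalClosure_span (M : X →L[ℝ] X) {S : Set X} (hS : MapsTo M S S) {u : X}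
    (hu : u ∈ (Submodule.span ℝ S).topologicalClosure) :
    M u ∈ (Submodule.span ℝ S).topologicalClosure :=
  have hspan : Submodule.span ℝ S ≤ (Submodule.span ℝ S).comap M.toLinearMap :=
    Submodule.span_le.2 fun _ hv => Submodule.subset_span (hS hv)
  map_mem_closure M.continuous hu fun _ hw => hspan hw

end Leibniz

/-! ### Test functions -/

namespace IsTestFunction

variable {d : ℕ} {Ω : Set (E d)} {φ ψ : E d → ℝ}

theorem exists_bound (hφ : IsTestFunction Ω φ) : ∃ C, ∀ x, ‖φ x‖ ≤ C :=
  hφ.compact.exists_bound_of_continuous hφ.smooth.continuous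

theorem memLp (hφ : IsTestFunction Ω φ) (p : ENNReal) (μ : Measure (E d))
    [IsFiniteMeasureOnCompacts μ] : MemLp φ p μ :=
  hφ.smooth.continuous.memLp_of_hasCompactSupport hφ.compact

theorem exists_lipschitzWith (hφ : IsTestFunction Ω φ) : ∃ L, LipschitzWith L φ :=
  (hφ.smooth.of_le (by simp : (1 : ℕ∞ω) ≤ ∞)).lipschitzWith_of_hasCompactSupport hφ.compact
    one_ne_zero

theorem mul (hφ : IsTestFunction Ω φ) (hψ : IsTestFunction Ω ψ) :
    IsTestFunction Ω fun x => φ x * ψ x :=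
  ⟨hφ.smooth.mul hψ.smooth, hφ.compact.mul_right,
    tsupport_mul_subset_left.trans hφ.support_subset⟩

end IsTestFunction

/-! ### Multiplication by test functions in the integral spaces -/

section Kernel

variable {V : Type*} [NormedAddCommGroup V] [NormedSpace ℝ V] [FiniteDimensional ℝ V]
  [MeasurableSpace V] [BorelSpace V] (μ : Measure V) [μ.IsAddHaarMeasure] {r : ℝ}

theorem integrableOn_ball_sq_div_rpow_norm (hV : 0 < Module.finrank ℝ V)
    (hr : r < Module.finrank ℝ V + 2) :
    IntegrableOn (fun z : V => ‖z‖ ^ 2 / ‖z‖ ^ r) (Metric.ball 0 1) μ := by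
  refine integrableOn_ball_of_norm_le_rpow (C := 1) (α := r - 2) hV (by linarith)
    ?_ (by fun_prop : Measurable _).aestronglyMeasurable
  refine ae_of_all _ fun z => ?_
  rw [Real.norm_of_nonneg (by positivity), one_mul, neg_sub]
  rcases eq_or_ne z 0 with rfl | hz
  · simpa using Real.rpow_nonneg le_rfl _
  · rw [Real.rpow_sub (norm_pos_iff.2 hz), Real.rpow_two]

theorem integrableOn_compl_ball_inv_rpow_norm (hr : Module.finrank ℝ V < r) :
    IntegrableOn (fun z : V => (‖z‖ ^ r)⁻¹) (Metric.ball 0 1)ᶜ μ := by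
  have hr0 : 0 ≤ r := (Nat.cast_nonneg _).trans hr.le
  refine ((integrable_one_add_norm (μ := μ) hr).const_mul (2 ^ r)).integrableOn.mono'
    (by fun_prop : Measurable _).aestronglyMeasurable ?_
  filter_upwards [ae_restrict_mem Metric.isOpen_ball.measurableSet.compl] with z hz
  have hz1 : 1 ≤ ‖z‖ := by simpa using hz
  rw [Real.norm_of_nonneg (by positivity), Real.rpow_neg (by positivity), ← div_eq_mul_inv,
    inv_le_comm₀ (by positivity) (by positivity), inv_div, div_le_iff₀ (by positivity),
    ← Real.mul_rpow (by positivity) (by positivity)]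
  exact Real.rpow_le_rpow (by positivity) (by linarith) hr0

theorem integrable_min_sq_div_rpow_norm (hr : Module.finrank ℝ V < r)
    (hr' : r < Module.finrank ℝ V + 2) (hV : 0 < Module.finrank ℝ V) {a b : ℝ} (ha : 0 ≤ a)
    (hb : 0 ≤ b) : Integrable (fun z : V => min a (b * ‖z‖ ^ 2) / ‖z‖ ^ r) μ := by
  have hmeas : Measurable fun z : V => min a (b * ‖z‖ ^ 2) / ‖z‖ ^ r := by fun_prop
  have norm_eq (z : V) : ‖min a (b * ‖z‖ ^ 2) / ‖z‖ ^ r‖ = min a (b * ‖z‖ ^ 2) / ‖z‖ ^ r :=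
    Real.norm_of_nonneg (by positivity)
  rw [← integrableOn_univ, ← union_compl_self (Metric.ball (0 : V) 1)]
  refine IntegrableOn.union ?_ ?_
  · refine ((integrableOn_ball_sq_div_rpow_norm μ hV hr').const_mul b).mono'
      hmeas.aestronglyMeasurable (ae_of_all _ fun z => ?_)
    rw [norm_eq, ← mul_div_assoc]
    gcongr
    exact min_le_right _ _
  · refine ((integrableOn_compl_ball_inv_rpow_norm μ hr).const_mul a).mono'
      hmeas.aestronglyMeasurable (ae_of_all _ fun z => ?_)
    rw [norm_eq, ← div_eq_mul_inv]
    gcongr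
    exact min_le_left _ _

end Kernel

section Integral

variable {d : ℕ} {s : ℝ} {Ω : Set (E d)} {φ : E d → ℝ}

theorem fracConst_nonneg (hs : s ∈ Ioo (0 : ℝ) 1) : 0 ≤ fracConst d s := by
  have := hs.1
  have := Real.Gamma_pos_of_pos (sub_pos.2 hs.2)
  have := Real.Gamma_pos_of_pos (by positivity : 0 < s + d / 2)
  unfold fracConst
  positivity

theorem quasiMeasurePreserving_snd_gagliardo :
    Measure.QuasiMeasurePreserving Prod.snd (gagliardo Ω s)
      ((volume : Measure (E d)).restrict Ω) :=
  Measure.quasiMeasurePreserving_snd.mono_left (withDensity_absolutelyContinuous _ _)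

theorem sq_sub_le_min {L : NNReal} {C : ℝ} (hC : ∀ x, ‖φ x‖ ≤ C) (hL : LipschitzWith L φ)
    (x y : E d) : (φ x - φ y) ^ 2 ≤ min ((2 * C) ^ 2) (L ^ 2 * ‖x - y‖ ^ 2) := by
  rw [← mul_pow, ← sq_abs (φ x - φ y), ← Real.norm_eq_abs]
  refine le_min (pow_le_pow_left₀ (norm_nonneg _) ?_ 2) (pow_le_pow_left₀ (norm_nonneg _) ?_ 2)
  · linarith [norm_sub_le (φ x) (φ y), hC x, hC y]
  · simpa only [dist_eq_norm] using hL.dist_le_mul x y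

theorem lintegral_commutator_gagliardo_le {h : E d → ENNReal} (hh : Measurable h)
    (hφ : Measurable φ) (hφh : ∀ x y, ENNReal.ofReal (fracConst d s / 2 /
      ‖x - y‖ ^ ((d : ℝ) + 2 * s)) * ‖φ x - φ y‖ₑ ^ 2 ≤ h (x - y))
    {f : E d → ℝ} (hf : Measurable f) :
    ∫⁻ z, ‖(φ z.1 - φ z.2) * f z.2‖ₑ ^ 2 ∂(gagliardo Ω s) ≤
      (∫⁻ z, h z) * ∫⁻ y in Ω, ‖f y‖ₑ ^ 2 := by
  rw [gagliardo, lintegral_withDensity_eq_lintegral_mul _ (by fun_prop) (by fun_prop),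
    lintegral_prod_symm' _ (by fun_prop), ← lintegral_const_mul _ (by fun_prop)]
  refine lintegral_mono fun y => ?_
  calc ∫⁻ x in Ω, _ ≤ ∫⁻ x, h (x - y) * ‖f y‖ₑ ^ 2 := by
        refine (setLIntegral_le_lintegral _ _).trans (lintegral_mono fun x => ?_)
        rw [Pi.mul_apply, enorm_mul, mul_pow, ← mul_assoc]
        gcongr
        exact hφh x y
    _ = (∫⁻ z, h z) * ‖f y‖ₑ ^ 2 := by
        rw [lintegral_mul_const _ (by fun_prop), lintegral_sub_right_eq_self h y]

theorem exists_commutator_gagliardo (hd : 0 < d) (hs : s ∈ Ioo (0 : ℝ) 1) (Ω : Set (E d))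
    {L : NNReal} {C : ℝ} (hC : ∀ x, ‖φ x‖ ≤ C) (hL : LipschitzWith L φ) :
    ∃ D : L2 Ω →L[ℝ] Lp ℝ 2 (gagliardo Ω s),
      ∀ f, D f =ᵐ[gagliardo Ω s] fun z => (φ z.1 - φ z.2) * f z.2 := by
  have hφ : Measurable φ := hL.continuous.measurable
  have hc := fracConst_nonneg (d := d) hs
  obtain ⟨h, h_def⟩ : ∃ h : E d → ℝ, h = fun z => fracConst d s / 2 *
    (min ((2 * C) ^ 2) (L ^ 2 * ‖z‖ ^ 2) / ‖z‖ ^ ((d : ℝ) + 2 * s)) := ⟨_, rfl⟩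
  have hh : Integrable h := by
    rw [h_def]
    refine (integrable_min_sq_div_rpow_norm volume ?_ ?_ ?_ (by positivity)
      (by positivity)).const_mul _ <;> rw [finrank_euclideanSpace_fin]
    exacts [by linarith [hs.1], by linarith [hs.2], hd]
  have hφh (x y : E d) : ENNReal.ofReal (fracConst d s / 2 / ‖x - y‖ ^ ((d : ℝ) + 2 * s)) *
      ‖φ x - φ y‖ₑ ^ 2 ≤ ENNReal.ofReal (h (x - y)) := by
    rw [← enorm_pow, Real.enorm_of_nonneg (sq_nonneg _), ← ENNReal.ofReal_mul (by positivity),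
      div_mul_eq_mul_div, mul_div_assoc]
    simp only [h_def]
    gcongr
    exact sq_sub_le_min hC hL x y
  obtain ⟨K, hK⟩ : ∃ K : NNReal, (K : ENNReal) ^ 2 = ∫⁻ z, ENNReal.ofReal (h z) :=
    ⟨NNReal.sqrt (∫⁻ z, ENNReal.ofReal (h z)).toNNReal, by
      rw [← ENNReal.coe_pow, NNReal.sq_sqrt, ENNReal.coe_toNNReal hh.lintegral_lt_top.ne]⟩
  refine exists_weightedComposition_Lp (F := ℝ) (p := 2) (K := K) (by fun_prop :
    Measurable fun z : E d × E d => φ z.1 - φ z.2).aestronglyMeasurable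
    quasiMeasurePreserving_snd_gagliardo fun f hf => ?_
  simp only [smul_eq_mul]
  rw [← ENNReal.pow_le_pow_left_iff two_ne_zero, mul_pow, eLpNorm_two_sq, eLpNorm_two_sq, hK]
  exact lintegral_commutator_gagliardo_le (by subst h_def; fun_prop) hφ hφh hf.measurable

theorem exists_mul_Hs (hd : 0 < d) (hs : s ∈ Ioo (0 : ℝ) 1) (Ω : Set (E d)) {L : NNReal} {C : ℝ}
    (hC : ∀ x, ‖φ x‖ ≤ C) (hL : LipschitzWith L φ) :
    ∃ M : Hs Ω s →L[ℝ] Hs Ω s,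
      ∀ u, (M u).1.fst =ᵐ[(volume : Measure (E d)).restrict Ω] fun x => φ x * u.1.fst x := by
  have hφ : Measurable φ := hL.continuous.measurable
  have hφ₁ : MemLp φ ⊤ ((volume : Measure (E d)).restrict Ω) :=
    memLp_top_of_bound hφ.aestronglyMeasurable C (ae_of_all _ hC)
  have hφ₂ : MemLp (fun z => φ z.1) ⊤ (gagliardo Ω s) :=
    memLp_top_of_bound (by fun_prop : Measurable _).aestronglyMeasurable C
      (ae_of_all _ fun z => hC z.1)
  obtain ⟨D, hD⟩ := exists_commutator_gagliardo hd hs Ω hC hL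
  let N := leibnizMap (mulLp (.mul ℝ ℝ) hφ₁) (mulLp (.mul ℝ ℝ) hφ₂) D
  have hN (p) (hp : p ∈ Hs Ω s) : N p ∈ Hs Ω s := by
    change ∀ᵐ z ∂(gagliardo Ω s), (N p).snd z = (N p).fst z.1 - (N p).fst z.2
    rw [leibnizMap_fst, leibnizMap_snd]
    filter_upwards [hp, Lp.coeFn_add _ (D p.fst), coeFn_mulLp (.mul ℝ ℝ) hφ₂ p.snd,
      hD p.fst, ae_gagliardo_of_ae s (coeFn_mulLp (.mul ℝ ℝ) hφ₁ p.fst)] with z h1 h2 h3 h4 h5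
    rw [h2, Pi.add_apply, h3, h4, h5.1, h5.2, h1]
    simp only [ContinuousLinearMap.mul_apply']
    ring
  exact ⟨(N ∘L (Hs Ω s).subtypeL).codRestrict (Hs Ω s) fun u => hN u.1 u.2,
    fun u => coeFn_mulLp (.mul ℝ ℝ) hφ₁ u.1.fst⟩

theorem exists_mul_H0s (hd : 0 < d) (hs : s ∈ Ioo (0 : ℝ) 1) (hφ : IsTestFunction Ω φ)
    (u : H0s Ω s) : ∃ v : H0s Ω s, v.1.1.fst =ᵐ[(volume : Measure (E d)).restrict Ω]
      fun x => φ x * u.1.1.fst x := by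
  obtain ⟨C, hC⟩ := hφ.exists_bound
  obtain ⟨L, hL⟩ := hφ.exists_lipschitzWith
  obtain ⟨M, hM⟩ := exists_mul_Hs hd hs Ω hC hL
  refine ⟨⟨M u.1, map_mem_topologicalClosure_span M ?_ u.2⟩, hM u.1⟩
  rintro w ⟨ψ, hψ, hwψ⟩
  refine ⟨_, hφ.mul hψ, ?_⟩
  filter_upwards [hM w, hwψ] with x h1 h2
  rw [h1, h2]

theorem exists_mul_HTilde (hd : 0 < d) (hs : s ∈ Ioo (0 : ℝ) 1) {L : NNReal} {C : ℝ}
    (hC : ∀ x, ‖φ x‖ ≤ C) (hL : LipschitzWith L φ) (u : HTilde Ω s) :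
    ∃ v : HTilde Ω s, v.1.1.fst =ᵐ[(volume : Measure (E d)).restrict univ]
      fun x => φ x * u.1.1.fst x := by
  obtain ⟨M, hM⟩ := exists_mul_Hs hd hs univ hC hL
  refine ⟨⟨M u.1, ?_⟩, hM u.1⟩
  change ∀ᵐ x ∂((volume : Measure (E d)).restrict univ), x ∉ Ω → (M u.1).1.fst x = 0
  filter_upwards [hM u.1, u.2] with x h1 h2 hx
  rw [h1, h2 hx, mul_zero]

end Integral

/-! ### The space `H_0^1` -/

section Translation

theorem lintegral_enorm_sq_le {α F : Type*} [MeasurableSpace α] [NormedAddCommGroup F]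
    {μ : Measure α} [IsProbabilityMeasure μ] {f : α → F} (hf : AEStronglyMeasurable f μ) :
    (∫⁻ x, ‖f x‖ₑ ∂μ) ^ 2 ≤ ∫⁻ x, ‖f x‖ₑ ^ 2 ∂μ := by
  rw [← eLpNorm_two_sq, ← eLpNorm_one_eq_lintegral_enorm]
  exact pow_le_pow_left' (eLpNorm_le_eLpNorm_of_exponent_le one_le_two hf) 2

variable {V F : Type*} [NormedAddCommGroup V] [NormedSpace ℝ V] [NormedAddCommGroup F]
  [NormedSpace ℝ F] {f : V → F}

theorem enorm_add_sub_sq_le_lintegral_fderiv (hf : ContDiff ℝ 1 f) (x z : V) :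
    ‖f (x + z) - f x‖ₑ ^ 2 ≤
      ∫⁻ τ in Icc (0 : ℝ) 1, ‖z‖ₑ ^ 2 * ‖fderiv ℝ f (x + τ • z)‖ₑ ^ 2 := by
  have isProbabilityMeasure_Icc : IsProbabilityMeasure (volume.restrict (Icc (0 : ℝ) 1)) :=
    ⟨by simp⟩
  have hline : ContDiff ℝ 1 fun τ : ℝ => f (x + τ • z) := by fun_prop
  have hderiv (τ : ℝ) : deriv (fun τ : ℝ => f (x + τ • z)) τ = fderiv ℝ f (x + τ • z) z := by
    have hsegment : HasDerivAt (fun τ : ℝ => x + τ • z) z τ := by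
      simpa using ((hasDerivAt_id τ).smul_const z).const_add x
    exact ((hf.differentiable one_ne_zero _).hasFDerivAt.comp_hasDerivAt τ hsegment).deriv
  calc ‖f (x + z) - f x‖ₑ ^ 2
      ≤ (∫⁻ τ in Icc (0 : ℝ) 1, ‖deriv (fun τ : ℝ => f (x + τ • z)) τ‖ₑ) ^ 2 := by
        gcongr
        simpa using enorm_sub_le_lintegral_deriv_of_contDiffOn_Icc hline.contDiffOn zero_le_one
    _ ≤ ∫⁻ τ in Icc (0 : ℝ) 1, ‖deriv (fun τ : ℝ => f (x + τ • z)) τ‖ₑ ^ 2 :=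
        lintegral_enorm_sq_le (hline.continuous_deriv le_rfl).aestronglyMeasurable
    _ ≤ ∫⁻ τ in Icc (0 : ℝ) 1, ‖z‖ₑ ^ 2 * ‖fderiv ℝ f (x + τ • z)‖ₑ ^ 2 := by
        gcongr with τ
        rw [hderiv, ← mul_pow, mul_comm]
        gcongr
        exact ContinuousLinearMap.le_opENorm _ _

theorem lintegral_enorm_add_sub_sq_le [MeasurableSpace V] [BorelSpace V] {μ : Measure V}
    [SFinite μ] [μ.IsAddRightInvariant] (hf : ContDiff ℝ 1 f) (z : V) :
    ∫⁻ x, ‖f (x + z) - f x‖ₑ ^ 2 ∂μ ≤ ‖z‖ₑ ^ 2 * ∫⁻ x, ‖fderiv ℝ f x‖ₑ ^ 2 ∂μ := by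
  have hf' : Continuous (fderiv ℝ f) := hf.continuous_fderiv one_ne_zero
  calc ∫⁻ x, ‖f (x + z) - f x‖ₑ ^ 2 ∂μ
      ≤ ∫⁻ x, (∫⁻ τ in Icc (0 : ℝ) 1, ‖z‖ₑ ^ 2 * ‖fderiv ℝ f (x + τ • z)‖ₑ ^ 2) ∂μ :=
        lintegral_mono fun x => enorm_add_sub_sq_le_lintegral_fderiv hf x z
    _ = ∫⁻ τ in Icc (0 : ℝ) 1, ∫⁻ x, ‖z‖ₑ ^ 2 * ‖fderiv ℝ f (x + τ • z)‖ₑ ^ 2 ∂μ := by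
        refine lintegral_lintegral_swap (Measurable.aemeasurable ?_)
        have : Continuous fun p : V × ℝ => fderiv ℝ f (p.1 + p.2 • z) := by fun_prop
        exact (this.enorm.measurable.pow_const 2).const_mul _
    _ = ∫⁻ _ in Icc (0 : ℝ) 1, ‖z‖ₑ ^ 2 * ∫⁻ x, ‖fderiv ℝ f x‖ₑ ^ 2 ∂μ := by
        refine lintegral_congr fun τ => ?_
        rw [lintegral_add_right_eq_self fun x => ‖z‖ₑ ^ 2 * ‖fderiv ℝ f x‖ₑ ^ 2,
          lintegral_const_mul _ (hf'.enorm.measurable.pow_const 2)]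
    _ = ‖z‖ₑ ^ 2 * ∫⁻ x, ‖fderiv ℝ f x‖ₑ ^ 2 ∂μ := by simp

end Translation

theorem enorm_gradient {V : Type*} [NormedAddCommGroup V] [InnerProductSpace ℝ V]
    [CompleteSpace V] (f : V → ℝ) (x : V) : ‖gradient f x‖ₑ = ‖fderiv ℝ f x‖ₑ :=
  (InnerProductSpace.toDual ℝ V).symm.enorm_map _

namespace IsTestFunction

variable {d : ℕ} {Ω : Set (E d)} {φ ψ : E d → ℝ}

theorem zero (Ω : Set (E d)) : IsTestFunction Ω 0 :=
  ⟨contDiff_const, HasCompactSupport.zero, by simp [tsupport_eq_empty_iff.2]⟩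

theorem add (hφ : IsTestFunction Ω φ) (hψ : IsTestFunction Ω ψ) : IsTestFunction Ω (φ + ψ) :=
  ⟨hφ.smooth.add hψ.smooth, hφ.compact.add hψ.compact,
    (tsupport_add φ ψ).trans (union_subset hφ.support_subset hψ.support_subset)⟩

theorem const_smul (hφ : IsTestFunction Ω φ) (c : ℝ) : IsTestFunction Ω (c • φ) :=
  ⟨hφ.smooth.const_smul c, hφ.compact.smul_left,
    (tsupport_smul_subset_right (fun _ => c) φ).trans hφ.support_subset⟩

theorem differentiable (hφ : IsTestFunction Ω φ) : Differentiable ℝ φ :=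
  hφ.smooth.differentiable (by simp)

theorem eq_zero (hφ : IsTestFunction Ω φ) {x : E d} (hx : x ∉ Ω) : φ x = 0 :=
  image_eq_zero_of_notMem_tsupport fun h => hx (hφ.support_subset h)

theorem support_gradient_subset (hφ : IsTestFunction Ω φ) :
    Function.support (gradient φ) ⊆ Ω := by
  refine fun x hx => hφ.support_subset (support_fderiv_subset ℝ fun h => hx ?_)
  rw [gradient, h, map_zero]

theorem memLp_gradient (hφ : IsTestFunction Ω φ) (p : ENNReal) (μ : Measure (E d))
    [IsFiniteMeasureOnCompacts μ] : MemLp (gradient φ) p μ :=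
  ((InnerProductSpace.toDual ℝ (E d)).symm.continuous.comp
    (hφ.smooth.continuous_fderiv (by simp))).memLp_of_hasCompactSupport
    ((hφ.compact.fderiv ℝ).comp_left (map_zero _))

theorem enorm_sq_eq_lintegral_fderiv (hφ : IsTestFunction Ω φ) {U : L2Vec Ω}
    (hU : U =ᵐ[volume.restrict Ω] gradient φ) : ‖U‖ₑ ^ 2 = ∫⁻ x, ‖fderiv ℝ φ x‖ₑ ^ 2 := by
  have hsupport : Function.support (fun x => ‖gradient φ x‖ₑ ^ 2) ⊆ Ω := fun x hx =>
    hφ.support_gradient_subset fun h => hx (by simp [h])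
  simp only [Lp_enorm_two_sq, ← enorm_gradient]
  rw [← setLIntegral_eq_of_support_subset hsupport]
  exact lintegral_congr_ae (hU.mono fun x hx => by simp only [hx])

end IsTestFunction

section H10

variable {d : ℕ} {Ω : Set (E d)}

/-- The pairs `(φ, ∇φ)` with `φ ∈ C_c^∞(Ω)`, of which `H_0^1(Ω)` is the closure. -/
def testPairs (Ω : Set (E d)) : Submodule ℝ (WithLp 2 (L2 Ω × L2Vec Ω)) where
  carrier := {p | ∃ φ : E d → ℝ, IsTestFunction Ω φ ∧ p.fst =ᵐ[volume.restrict Ω] φ ∧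
    p.snd =ᵐ[volume.restrict Ω] gradient φ}
  zero_mem' := by
    refine ⟨0, .zero Ω, Lp.coeFn_zero _ _ _, (Lp.coeFn_zero _ _ _).trans (ae_of_all _ fun x => ?_)⟩
    simp [gradient]
  add_mem' := by
    rintro p q ⟨φ, hφ, hp₁, hp₂⟩ ⟨ψ, hψ, hq₁, hq₂⟩
    refine ⟨φ + ψ, hφ.add hψ, (Lp.coeFn_add _ _).trans (hp₁.add hq₁),
      (Lp.coeFn_add _ _).trans ((hp₂.add hq₂).trans (ae_of_all _ fun x => ?_))⟩
    simp only [gradient, Pi.add_apply, fderiv_add (hφ.differentiable x) (hψ.differentiable x),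
      map_add]
  smul_mem' := by
    rintro c p ⟨φ, hφ, hp₁, hp₂⟩
    refine ⟨c • φ, hφ.const_smul c, (Lp.coeFn_smul _ _).trans (hp₁.const_smul c),
      (Lp.coeFn_smul _ _).trans ((hp₂.const_smul c).trans (ae_of_all _ fun x => ?_))⟩
    simp only [gradient, Pi.smul_apply, fderiv_const_smul (hφ.differentiable x), map_smul]

theorem H10_eq_topologicalClosure_testPairs (Ω : Set (E d)) :
    H10 Ω = (testPairs Ω).topologicalClosure :=
  congrArg Submodule.topologicalClosure (testPairs Ω).span_eq

theorem H10_induction {P : WithLp 2 (L2 Ω × L2Vec Ω) → Prop} (hP : IsClosed {p | P p})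
    (htest : ∀ p (φ : E d → ℝ), IsTestFunction Ω φ → p.fst =ᵐ[volume.restrict Ω] φ →
      p.snd =ᵐ[volume.restrict Ω] gradient φ → P p)
    {p : WithLp 2 (L2 Ω × L2Vec Ω)} (hp : p ∈ H10 Ω) : P p := by
  rw [H10_eq_topologicalClosure_testPairs] at hp
  have hsub : (testPairs Ω : Set (WithLp 2 (L2 Ω × L2Vec Ω))) ⊆ {p | P p} :=
    fun q ⟨φ, hφ, h₁, h₂⟩ => htest q φ hφ h₁ h₂
  exact closure_minimal hsub hP hp

instance (Ω : Set (E d)) : CompleteSpace (H10 Ω) :=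
  (Submodule.isClosed_topologicalClosure _).completeSpace_coe

theorem exists_forall_add_notMem {V : Type*} [NormedAddCommGroup V] [NormedSpace ℝ V]
    [Nontrivial V] {s : Set V} (hs : Bornology.IsBounded s) : ∃ z, ∀ x ∈ s, x + z ∉ s := by
  obtain ⟨R, hR⟩ := hs.exists_norm_le
  obtain ⟨z, hz⟩ := NormedSpace.exists_lt_norm ℝ V (R + R)
  refine ⟨z, fun x hx hxz => hz.not_ge ?_⟩
  simpa using (norm_sub_le (x + z) x).trans (add_le_add (hR _ hxz) (hR _ hx))

-- Poincaré's inequality, by translating `Ω` off itself.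
theorem exists_norm_fst_le_norm_snd_of_mem_H10 (hd : 0 < d) (hΩ : Bornology.IsBounded Ω) :
    ∃ C, ∀ p ∈ H10 Ω, ‖p.fst‖ ≤ C * ‖p.snd‖ := by
  have : Nonempty (Fin d) := ⟨⟨0, hd⟩⟩
  obtain ⟨z, hz⟩ := exists_forall_add_notMem hΩ
  refine ⟨‖z‖, fun p hp => H10_induction (isClosed_le
    (WithLp.continuous_fst 2 _ _).norm ((WithLp.continuous_snd 2 _ _).norm.const_mul _)) ?_ hp⟩
  intro p φ hφ h₁ h₂
  have hpt (x : E d) : ‖φ x‖ₑ ≤ ‖φ (x + z) - φ x‖ₑ := by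
    by_cases hx : x ∈ Ω
    · simp [hφ.eq_zero (hz x hx)]
    · simp [hφ.eq_zero hx]
  have hsq : ‖p.fst‖ₑ ^ 2 ≤ (‖z‖ₑ * ‖p.snd‖ₑ) ^ 2 :=
    calc ‖p.fst‖ₑ ^ 2 = ∫⁻ x in Ω, ‖φ x‖ₑ ^ 2 := by
          rw [Lp_enorm_two_sq]
          exact lintegral_congr_ae (h₁.mono fun x hx => by simp only [hx])
      _ ≤ ∫⁻ x in Ω, ‖φ (x + z) - φ x‖ₑ ^ 2 := lintegral_mono fun x => pow_le_pow_left' (hpt x) 2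
      _ ≤ ∫⁻ x, ‖φ (x + z) - φ x‖ₑ ^ 2 := setLIntegral_le_lintegral _ _
      _ ≤ ‖z‖ₑ ^ 2 * ∫⁻ x, ‖fderiv ℝ φ x‖ₑ ^ 2 :=
          lintegral_enorm_add_sub_sq_le (hφ.smooth.of_le (by simp)) z
      _ = (‖z‖ₑ * ‖p.snd‖ₑ) ^ 2 := by rw [mul_pow, hφ.enorm_sq_eq_lintegral_fderiv h₂]
  have hle := (ENNReal.pow_le_pow_left_iff two_ne_zero).1 hsq
  rw [← enorm_norm z, ← enorm_smul, enorm_le_iff_norm_le] at hle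
  simpa [norm_smul] using hle

theorem exists_mul_mem_H10 (hd : 0 < d) (hΩ : Bornology.IsBounded Ω) {φ : E d → ℝ}
    (hφ : IsTestFunction Ω φ) :
    ∃ K, ∀ p ∈ H10 Ω, ∃ q ∈ H10 Ω,
      q.fst = mulLp (.lsmul ℝ ℝ) (hφ.memLp ⊤ (volume.restrict Ω)) p.fst ∧
        ‖q.snd‖ ≤ K * ‖p.snd‖ := by
  obtain ⟨C, hpoincare⟩ := exists_norm_fst_le_norm_snd_of_mem_H10 hd hΩ
  let B : L2Vec Ω →L[ℝ] L2Vec Ω := mulLp (.lsmul ℝ ℝ) (hφ.memLp ⊤ (volume.restrict Ω))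
  let D : L2 Ω →L[ℝ] L2Vec Ω :=
    mulLp (ContinuousLinearMap.lsmul ℝ ℝ).flip (hφ.memLp_gradient ⊤ (volume.restrict Ω))
  let M := leibnizMap (mulLp (.lsmul ℝ ℝ) (hφ.memLp ⊤ (volume.restrict Ω))) B D
  refine ⟨‖B‖ + ‖D‖ * C, fun p hp => ⟨M p, map_mem_topologicalClosure_span M ?_ hp, rfl, ?_⟩⟩
  · rintro q ⟨ψ, hψ, h₁, h₂⟩
    refine ⟨_, hφ.mul hψ, ?_, ?_⟩
    · filter_upwards [coeFn_mulLp (.lsmul ℝ ℝ) (hφ.memLp ⊤ (volume.restrict Ω)) q.fst, h₁]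
        with x hM hq
      rw [leibnizMap_fst, hM, hq, ContinuousLinearMap.lsmul_apply, smul_eq_mul]
    · filter_upwards [coeFn_mulLp (.lsmul ℝ ℝ) (hφ.memLp ⊤ (volume.restrict Ω)) q.snd,
        coeFn_mulLp (ContinuousLinearMap.lsmul ℝ ℝ).flip
          (hφ.memLp_gradient ⊤ (volume.restrict Ω)) q.fst,
        h₁, h₂, Lp.coeFn_add (B q.snd) (D q.fst)] with x hB hD hq₁ hq₂ hadd
      rw [leibnizMap_snd, hadd, Pi.add_apply, hB, hD, hq₁, hq₂]
      simp only [gradient, fderiv_fun_mul (hφ.differentiable x) (hψ.differentiable x), map_add,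
        map_smul, ContinuousLinearMap.lsmul_apply, ContinuousLinearMap.flip_apply]
  · calc ‖B p.snd + D p.fst‖ ≤ ‖B‖ * ‖p.snd‖ + ‖D‖ * (C * ‖p.snd‖) :=
          norm_add_le_of_le (B.le_opNorm _) (D.le_opNorm_of_le (hpoincare p hp))
      _ = (‖B‖ + ‖D‖ * C) * ‖p.snd‖ := by ring

end H10

/-! ### Compactness of the embedding of `H_0^1` into `L²` -/

section FiniteDimensionalApproximation

theorem norm_sub_starProjection_le {𝕜 Y : Type*} [RCLike 𝕜] [NormedAddCommGroup Y]
    [InnerProductSpace 𝕜 Y] {K : Submodule 𝕜 Y} [K.HasOrthogonalProjection] (y : Y) {g : Y}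
    (hg : g ∈ K) : ‖y - K.starProjection y‖ ≤ ‖y - g‖ := by
  rw [Submodule.starProjection_minimal]
  exact ciInf_le (f := fun x : K => ‖y - x‖)
    ⟨0, forall_mem_range.2 fun x => norm_nonneg _⟩ ⟨g, hg⟩

theorem isCompactOperator_of_finiteDimensional_approx {X Y : Type*} [NormedAddCommGroup X]
    [NormedSpace ℝ X] [NormedAddCommGroup Y] [InnerProductSpace ℝ Y] [CompleteSpace Y]
    (T : X →L[ℝ] Y)
    (hT : ∀ ε > 0, ∃ (K : Submodule ℝ Y) (_ : FiniteDimensional ℝ K),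
      ∀ x, ‖T x - K.starProjection (T x)‖ ≤ ε * ‖x‖) : IsCompactOperator T := by
  choose K hK hKT using fun n : ℕ => hT (1 / ((n : ℝ) + 1)) (by positivity)
  refine isCompactOperator_of_tendsto (l := atTop)
    (F := fun n => (K n).starProjection.comp T) ?_ (Eventually.of_forall fun n => ?_)
  · rw [tendsto_iff_norm_sub_tendsto_zero]
    refine squeeze_zero (fun _ => norm_nonneg _) (fun n => ?_)
      tendsto_one_div_add_atTop_nhds_zero_nat
    refine ContinuousLinearMap.opNorm_le_bound _ (by positivity) fun x => ?_
    rw [sub_apply, norm_sub_rev]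
    exact hKT n x
  · exact (isCompactOperator_of_locallyCompactSpace_rng (K n).subtypeL).comp_clm
      ((K n).orthogonalProjectionOnto.comp T)

theorem exists_finiteDimensional_forall_comp_mem {α κ : Type*} [MeasurableSpace α]
    [MeasurableSpace κ] [DiscreteMeasurableSpace κ] {μ : Measure α} [IsFiniteMeasure μ]
    {ι : α → κ} (hι : Measurable ι) {I : Set κ} (hI : I.Finite) (hιI : ∀ᵐ x ∂μ, ι x ∈ I) :
    ∃ K : Submodule ℝ (Lp ℝ 2 μ), FiniteDimensional ℝ K ∧
      ∀ c : κ → ℝ, ∃ g ∈ K, g =ᵐ[μ] fun x => c (ι x) := by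
  have mem (c : κ → ℝ) : MemLp (fun x => c (ι x)) 2 μ := by
    obtain ⟨C, hC⟩ := (hI.image fun k => ‖c k‖).bddAbove
    exact MemLp.of_bound (Measurable.of_discrete.comp hι).aestronglyMeasurable C
      (hιI.mono fun x hx => hC (mem_image_of_mem _ hx))
  let T : (κ → ℝ) →ₗ[ℝ] Lp ℝ 2 μ :=
    { toFun c := (mem c).toLp _
      map_add' _ _ := rfl
      map_smul' _ _ := rfl }
  have : Finite I := hI
  refine ⟨LinearMap.range (T ∘ₗ Function.ExtendByZero.linearMap ℝ ((↑) : I → κ)), inferInstance,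
    fun c => ⟨_, ⟨fun i => c i, rfl⟩, ?_⟩⟩
  refine (mem _).coeFn_toLp.trans (hιI.mono fun x hx => ?_)
  exact Subtype.val_injective.extend_apply (fun i : I => c i) 0 ⟨ι x, hx⟩

end FiniteDimensionalApproximation

section Grid

theorem enorm_sub_setAverage_sq_le {α F : Type*} [MeasurableSpace α] [NormedAddCommGroup F]
    [NormedSpace ℝ F] [CompleteSpace F] {μ : Measure α} {s : Set α} (h₀ : μ s ≠ 0) (h : μ s ≠ ⊤)
    {f : α → F} (hf : IntegrableOn f s μ) (c : F) :
    ‖c - ⨍ x in s, f x ∂μ‖ₑ ^ 2 ≤ (μ s)⁻¹ * ∫⁻ x in s, ‖c - f x‖ₑ ^ 2 ∂μ := by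
  have isProbabilityMeasure_normalized : IsProbabilityMeasure ((μ s)⁻¹ • μ.restrict s) :=
    ⟨by simp [ENNReal.inv_mul_cancel h₀ h]⟩
  have hf' : Integrable f ((μ s)⁻¹ • μ.restrict s) := hf.smul_measure (ENNReal.inv_ne_top.2 h₀)
  have hsub : c - ⨍ x in s, f x ∂μ = ∫ x, c - f x ∂((μ s)⁻¹ • μ.restrict s) := by
    rw [setAverage_eq', integral_sub (integrable_const c) hf', integral_const, probReal_univ,
      one_smul]
  rw [hsub, ← smul_eq_mul, ← lintegral_smul_measure]
  exact (pow_le_pow_left' (enorm_integral_le_lintegral_enorm _) 2).trans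
    (lintegral_enorm_sq_le ((integrable_const c).sub hf').aestronglyMeasurable)

variable {d : ℕ} (n : ℕ)

/-- The index of the cell of the grid `n⁻¹ ℤ^d` that contains `x`. -/
def gridIndex (x : E d) : Fin d → ℤ := BoxIntegral.unitPartition.index n x.ofLp

theorem measurable_gridIndex : Measurable (gridIndex n : E d → Fin d → ℤ) :=
  measurable_pi_lambda _ fun i =>
    ((by fun_prop : Measurable fun x : E d => (n : ℝ) * x i).ceil).sub_const 1

theorem finite_image_gridIndex {Ω : Set (E d)} (hΩ : Bornology.IsBounded Ω) :
    (gridIndex n '' Ω).Finite := by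
  obtain ⟨R, hR⟩ := hΩ.exists_norm_le
  refine (finite_Icc (fun _ : Fin d => ⌈n * -R⌉ - 1) fun _ => ⌈n * R⌉ - 1).subset ?_
  rintro _ ⟨x, hx, rfl⟩
  have hi (i : Fin d) : |x i| ≤ R := (PiLp.norm_apply_le x i).trans (hR x hx)
  constructor <;> intro i <;>
    simp only [gridIndex, BoxIntegral.unitPartition.index_apply] <;> gcongr
  exacts [(abs_le.1 (hi i)).1, (abs_le.1 (hi i)).2]

variable [NeZero n]

/-- The cubes of side `1 / n` with corners in `n⁻¹ ℤ^d`: Mathlib's partition of `Fin d → ℝ`,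
transported to Euclidean space. -/
def gridCell (ν : Fin d → ℤ) : Set (E d) := WithLp.ofLp ⁻¹' (BoxIntegral.unitPartition.box n ν)

theorem mem_gridCell_gridIndex (x : E d) : x ∈ gridCell n (gridIndex n x) :=
  BoxIntegral.unitPartition.mem_box_iff_index.2 rfl

theorem volume_gridCell (ν : Fin d → ℤ) : volume (gridCell n ν) = ((n : ENNReal) ^ d)⁻¹ := by
  rw [gridCell, (PiLp.volume_preserving_ofLp (Fin d)).measure_preimage
    (BoxIntegral.unitPartition.box n ν).measurableSet_coe.nullMeasurableSet,
    BoxIntegral.unitPartition.volume_box, Fintype.card_fin, one_div]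

theorem gridCell_subset_closedBall {ν : Fin d → ℤ} {x : E d} (hx : x ∈ gridCell n ν) :
    gridCell n ν ⊆ Metric.closedBall x ((n : ℝ)⁻¹ * √d) := by
  intro y hy
  have hi (i : Fin d) : dist (y i) (x i) ^ 2 ≤ (n : ℝ)⁻¹ ^ 2 := by
    have hxi := BoxIntegral.unitPartition.mem_box_iff.1 hx i
    have hyi := BoxIntegral.unitPartition.mem_box_iff.1 hy i
    rw [add_div, one_div] at hxi hyi
    refine pow_le_pow_left₀ dist_nonneg ?_ 2
    rw [Real.dist_eq, abs_sub_le_iff]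
    constructor <;> linarith
  rw [Metric.mem_closedBall, EuclideanSpace.dist_eq]
  refine Real.sqrt_le_iff.2 ⟨by positivity, (Finset.sum_le_sum fun i _ => hi i).trans_eq ?_⟩
  simp [mul_pow, mul_comm]

variable {f : E d → ℝ}

theorem enorm_sub_gridAverage_sq_le (hf : Continuous f) (x : E d) :
    ‖f x - ⨍ y in gridCell n (gridIndex n x), f y‖ₑ ^ 2 ≤
      (n : ENNReal) ^ d *
        ∫⁻ z in Metric.closedBall 0 ((n : ℝ)⁻¹ * √d), ‖f (x + z) - f x‖ₑ ^ 2 := by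
  have hcell := gridCell_subset_closedBall n (mem_gridCell_gridIndex n x)
  have hpre : Metric.closedBall 0 ((n : ℝ)⁻¹ * √d) =
      (x + ·) ⁻¹' Metric.closedBall x ((n : ℝ)⁻¹ * √d) := by simp
  refine (enorm_sub_setAverage_sq_le ?_ ?_
    ((hf.continuousOn.integrableOn_compact (isCompact_closedBall _ _)).mono_set hcell) _).trans ?_
  · simp [volume_gridCell]
  · simp [volume_gridCell, NeZero.ne n]
  rw [volume_gridCell, inv_inv, hpre,
    (measurePreserving_add_left volume x).setLIntegral_comp_preimage_emb
      (measurableEmbedding_addLeft x) (fun y => ‖f y - f x‖ₑ ^ 2)]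
  simp only [enorm_sub_rev (f x)]
  exact mul_le_mul_right (lintegral_mono_set hcell) _

theorem lintegral_enorm_sub_gridAverage_sq_le (hf : ContDiff ℝ 1 f) :
    ∫⁻ x, ‖f x - ⨍ y in gridCell n (gridIndex n x), f y‖ₑ ^ 2 ≤
      volume (Metric.closedBall (0 : E d) (√d)) *
        (‖(n : ℝ)⁻¹ * √d‖ₑ ^ 2 * ∫⁻ x, ‖fderiv ℝ f x‖ₑ ^ 2) := by
  have hn : (n : ENNReal) ^ d ≠ 0 := by simp [NeZero.ne n]
  have hn' : (n : ENNReal) ^ d ≠ ⊤ := by simp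
  have hn0 : (0 : ℝ) < n := Nat.cast_pos.2 n.pos_of_neZero
  have hmeas : Measurable fun p : E d × E d => ‖f (p.1 + p.2) - f p.1‖ₑ ^ 2 := by
    have := hf.continuous
    exact (Continuous.measurable (by fun_prop)).pow_const 2
  calc ∫⁻ x, ‖f x - ⨍ y in gridCell n (gridIndex n x), f y‖ₑ ^ 2
      ≤ ∫⁻ x, n ^ d * ∫⁻ z in Metric.closedBall 0 ((n : ℝ)⁻¹ * √d), ‖f (x + z) - f x‖ₑ ^ 2 :=
        lintegral_mono (enorm_sub_gridAverage_sq_le n hf.continuous)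
    _ = n ^ d * ∫⁻ z in Metric.closedBall 0 ((n : ℝ)⁻¹ * √d), ∫⁻ x, ‖f (x + z) - f x‖ₑ ^ 2 := by
        rw [lintegral_const_mul' _ _ hn', lintegral_lintegral_swap hmeas.aemeasurable]
    _ ≤ n ^ d * ∫⁻ _ in Metric.closedBall (0 : E d) ((n : ℝ)⁻¹ * √d),
          ‖(n : ℝ)⁻¹ * √d‖ₑ ^ 2 * ∫⁻ x, ‖fderiv ℝ f x‖ₑ ^ 2 := by
        refine mul_le_mul_right (setLIntegral_mono' measurableSet_closedBall fun z hz => ?_) _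
        refine (lintegral_enorm_add_sub_sq_le hf z).trans ?_
        gcongr ?_ ^ 2 * _
        rw [enorm_le_iff_norm_le]
        exact (mem_closedBall_zero_iff.1 hz).trans (le_abs_self _)
    _ = _ := by
        rw [setLIntegral_const, Measure.addHaar_closedBall_mul _ _ (by positivity) (by positivity),
          finrank_euclideanSpace_fin, ENNReal.ofReal_pow (by positivity),
          ENNReal.ofReal_inv_of_pos hn0, ENNReal.ofReal_natCast, ← ENNReal.inv_pow,
          mul_left_comm, ENNReal.mul_inv_cancel_left hn hn', mul_comm]

end Grid

section Rellich

variable {d : ℕ} {Ω : Set (E d)}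

-- The approximants are the step functions of averages over the cells of the grid `n⁻¹ ℤ^d`.
theorem exists_finiteDimensional_approx_H10 (hΩ : Bornology.IsBounded Ω) :
    ∃ C : NNReal, ∀ (n : ℕ) [NeZero n], ∃ (K : Submodule ℝ (L2 Ω)) (_ : FiniteDimensional ℝ K),
      ∀ p ∈ H10 Ω, ‖p.fst - K.starProjection p.fst‖ ≤ C * (n : ℝ)⁻¹ * ‖p.snd‖ := by
  set V := (volume (Metric.closedBall (0 : E d) (√d))).toNNReal with hV
  have : IsFiniteMeasure (volume.restrict Ω) := isFiniteMeasure_restrict.2 hΩ.measure_lt_top.ne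
  refine ⟨NNReal.sqrt V * NNReal.sqrt d, fun n _ => ?_⟩
  have hindex : ∀ᵐ x ∂(volume.restrict Ω), gridIndex n x ∈ gridIndex n '' Ω :=
    (ae_restrict_iff (measurable_gridIndex n .of_discrete)).2
      (ae_of_all _ fun x hx => mem_image_of_mem _ hx)
  obtain ⟨K, hK, hstep⟩ := exists_finiteDimensional_forall_comp_mem (measurable_gridIndex n)
    (finite_image_gridIndex n hΩ) hindex
  have hfst := WithLp.continuous_fst 2 (L2 Ω) (L2Vec Ω)
  refine ⟨K, hK, fun p hp => H10_induction (isClosed_le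
    (hfst.sub (K.starProjection.continuous.comp hfst)).norm
    ((WithLp.continuous_snd 2 _ _).norm.const_mul _)) ?_ hp⟩
  intro p φ hφ h₁ h₂
  obtain ⟨g, hgK, hg⟩ := hstep fun ν => ⨍ y in gridCell n ν, φ y
  refine (norm_sub_starProjection_le p.fst hgK).trans ?_
  have hsq : ‖p.fst - g‖ₑ ^ 2 ≤ (NNReal.sqrt V * (‖(n : ℝ)⁻¹ * √d‖ₑ * ‖p.snd‖ₑ)) ^ 2 :=
    calc ‖p.fst - g‖ₑ ^ 2
        = ∫⁻ x in Ω, ‖φ x - ⨍ y in gridCell n (gridIndex n x), φ y‖ₑ ^ 2 := by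
          rw [Lp_enorm_two_sq]
          refine lintegral_congr_ae ?_
          filter_upwards [Lp.coeFn_sub p.fst g, h₁, hg] with x hsub hpx hgx
          rw [hsub, Pi.sub_apply, hpx, hgx]
      _ ≤ ∫⁻ x, ‖φ x - ⨍ y in gridCell n (gridIndex n x), φ y‖ₑ ^ 2 :=
          setLIntegral_le_lintegral _ _
      _ ≤ V * (‖(n : ℝ)⁻¹ * √d‖ₑ ^ 2 * ∫⁻ x, ‖fderiv ℝ φ x‖ₑ ^ 2) := by
          rw [hV, ENNReal.coe_toNNReal measure_closedBall_lt_top.ne]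
          exact lintegral_enorm_sub_gridAverage_sq_le n (hφ.smooth.of_le (by simp))
      _ = (NNReal.sqrt V * (‖(n : ℝ)⁻¹ * √d‖ₑ * ‖p.snd‖ₑ)) ^ 2 := by
          rw [← hφ.enorm_sq_eq_lintegral_fderiv h₂, mul_pow, mul_pow, ← ENNReal.coe_pow,
            NNReal.sq_sqrt]
  have hle := ENNReal.toReal_mono (by finiteness) ((ENNReal.pow_le_pow_left_iff two_ne_zero).1 hsq)
  simp only [ENNReal.toReal_mul, toReal_enorm, norm_mul, ENNReal.coe_toReal, norm_inv,
    RCLike.norm_natCast, Real.norm_of_nonneg (Real.sqrt_nonneg _)] at hle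
  refine hle.trans_eq ?_
  simp only [NNReal.coe_mul, Real.coe_sqrt, NNReal.coe_natCast]
  ring

/-- The embedding of `H_0^1(Ω)` into `L²(Ω)`. -/
def H10.embed (Ω : Set (E d)) : H10 Ω →L[ℝ] L2 Ω :=
  WithLp.fstL 2 ℝ (L2 Ω) (L2Vec Ω) ∘L (H10 Ω).subtypeL

theorem H10.embed_apply (p : H10 Ω) : H10.embed Ω p = p.1.fst := rfl

theorem H10.isCompactOperator_embed (hΩ : Bornology.IsBounded Ω) :
    IsCompactOperator (H10.embed Ω) := by
  obtain ⟨C, hC⟩ := exists_finiteDimensional_approx_H10 hΩ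
  refine isCompactOperator_of_finiteDimensional_approx _ fun ε hε => ?_
  obtain ⟨n, hn⟩ := exists_nat_gt (C / ε)
  have hn0 : (0 : ℝ) < n := (by positivity : 0 ≤ C / ε).trans_lt hn
  have : NeZero n := ⟨by exact_mod_cast hn0.ne'⟩
  obtain ⟨K, hK, hKC⟩ := hC n
  refine ⟨K, hK, fun p => (hKC p.1 p.2).trans ?_⟩
  gcongr
  · rw [← div_eq_mul_inv, div_le_iff₀ hn0]
    exact ((div_lt_iff₀' hε).1 hn).le
  · exact WithLp.norm_snd_le _ p.1

end Rellich

/-! ### Completeness of the Dirichlet eigenfunctions -/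

section CompactSymmetric

variable {𝕜 H : Type*} [RCLike 𝕜] [NormedAddCommGroup H] [InnerProductSpace 𝕜 H] [CompleteSpace H]
  {T : H →L[𝕜] H}

theorem exists_eigenvector_mem_of_mem_invtSubmodule (hT : IsCompactOperator T)
    (hT' : T.IsSymmetric) {V : Submodule 𝕜 H} (hV : IsClosed (V : Set H)) (hV₀ : V ≠ ⊥)
    (hVT : V ∈ Module.End.invtSubmodule (T : H →ₗ[𝕜] H)) :
    ∃ v ∈ V, v ≠ 0 ∧ ∃ κ : 𝕜, T v = κ • v := by
  have : CompleteSpace V := hV.completeSpace_coe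
  let T' : V →L[𝕜] V := T.restrict hVT
  have hbot := ContinuousLinearMap.orthogonalComplement_iSup_eigenspaces_eq_bot
    (T := T') (hT.restrict' hVT) (hT'.restrict_invariant hVT)
  obtain ⟨κ, hκ⟩ : ∃ κ, Module.End.eigenspace (T' : Module.End 𝕜 V) κ ≠ ⊥ := by
    by_contra! h
    have : Nontrivial V := Submodule.nontrivial_iff_ne_bot.2 hV₀
    simp [h] at hbot
  obtain ⟨v, hv, hv₀⟩ := Submodule.exists_mem_ne_zero_of_ne_bot hκ
  exact ⟨v, v.2, by simpa using hv₀, κ,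
    congrArg Subtype.val (Module.End.mem_eigenspace_iff.1 hv)⟩

theorem orthogonal_span_range_eq_bot_of_maximal (hT : IsCompactOperator T) (hT' : T.IsSymmetric)
    {ι : Type*} {e : ι → H} {κ : ι → 𝕜} (he : ∀ i, T (e i) = κ i • e i)
    (hmax : ∀ v ≠ 0, ∀ c : 𝕜, T v = c • v → ∃ i, inner 𝕜 (e i) v ≠ 0) :
    (Submodule.span 𝕜 (range e))ᗮ = ⊥ := by
  by_contra hne
  have hspan : Submodule.span 𝕜 (range e) ∈ Module.End.invtSubmodule (T : H →ₗ[𝕜] H) := by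
    rw [Module.End.mem_invtSubmodule, Submodule.span_le]
    rintro _ ⟨i, rfl⟩
    have : T (e i) ∈ Submodule.span 𝕜 (range e) :=
      he i ▸ Submodule.smul_mem _ _ (Submodule.subset_span (mem_range_self i))
    exact this
  obtain ⟨v, hv, hv₀, c, hc⟩ := exists_eigenvector_mem_of_mem_invtSubmodule hT hT'
    (Submodule.isClosed_orthogonal _) hne (hT'.orthogonalComplement_mem_invtSubmodule hspan)
  obtain ⟨i, hi⟩ := hmax v hv₀ c hc
  exact hi (hv _ (Submodule.subset_span (mem_range_self i)))

end CompactSymmetric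

section DirichletResolvent

variable {d : ℕ} {Ω : Set (E d)}

theorem IsTestFunction.exists_mem_H10 {φ : E d → ℝ} (hφ : IsTestFunction Ω φ) :
    ∃ p ∈ H10 Ω, p.fst =ᵐ[volume.restrict Ω] φ := by
  have hmem := hφ.memLp 2 (volume.restrict Ω)
  have hgrad := hφ.memLp_gradient 2 (volume.restrict Ω)
  exact ⟨WithLp.toLp 2 (hmem.toLp φ, hgrad.toLp (gradient φ)),
    Submodule.le_topologicalClosure _ (Submodule.subset_span
      ⟨φ, hφ, hmem.coeFn_toLp, hgrad.coeFn_toLp⟩), hmem.coeFn_toLp⟩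

theorem H10.orthogonal_range_embed (hΩ : IsOpen Ω) : (H10.embed Ω).rangeᗮ = ⊥ := by
  refine (Submodule.eq_bot_iff _).2 fun u hu => ?_
  have hloc : LocallyIntegrableOn (u : E d → ℝ) Ω :=
    locallyIntegrableOn_of_locallyIntegrable_restrict
      ((Lp.memLp u).locallyIntegrable one_le_two)
  have hzero := hΩ.ae_eq_zero_of_integral_contDiff_smul_eq_zero hloc fun g hg hgc hgs => by
    have hφ : IsTestFunction Ω g := ⟨hg, hgc, hgs⟩
    obtain ⟨p, hp, hpg⟩ := hφ.exists_mem_H10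
    rw [← setIntegral_eq_integral_of_forall_compl_eq_zero (s := Ω)
      (fun x hx => by rw [hφ.eq_zero hx, zero_smul]), ← hu p.fst ⟨⟨p, hp⟩, rfl⟩, L2.inner_def]
    refine integral_congr_ae (hpg.mono fun x hx => ?_)
    simp [hx, mul_comm]
  exact (Lp.eq_zero_iff_ae_eq_zero (f := u)).2 ((ae_restrict_iff' hΩ.measurableSet).2 hzero)

/-- The resolvent `(1 - Δ)⁻¹` of the Dirichlet Laplacian on `L²(Ω)`: the adjoint of the embedding
maps `u` to the weak solution `p` of `p - Δp = u`. -/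
def dirichletResolvent (Ω : Set (E d)) : L2 Ω →L[ℝ] L2 Ω :=
  H10.embed Ω ∘L (H10.embed Ω).adjoint

theorem isCompactOperator_dirichletResolvent (hb : Bornology.IsBounded Ω) :
    IsCompactOperator (dirichletResolvent Ω) :=
  (H10.isCompactOperator_embed hb).comp_clm _

theorem isSymmetric_dirichletResolvent (Ω : Set (E d)) : (dirichletResolvent Ω).IsSymmetric :=
  (ContinuousLinearMap.isPositive_self_comp_adjoint (H10.embed Ω)).isSymmetric

theorem ker_dirichletResolvent (hΩ : IsOpen Ω) : (dirichletResolvent Ω).ker = ⊥ := by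
  rw [dirichletResolvent, ContinuousLinearMap.ker_self_comp_adjoint,
    ← ContinuousLinearMap.orthogonal_range, H10.orthogonal_range_embed hΩ]

theorem inner_adjoint_embed (u : L2 Ω) (q : H10 Ω) :
    ⟪(H10.embed Ω).adjoint u, q⟫ = ⟪u, q.1.fst⟫ := by
  rw [ContinuousLinearMap.adjoint_inner_left, H10.embed_apply]

theorem one_add_smul_dirichletResolvent_eq_self_iff {μ : ℝ} {u : L2 Ω} :
    (1 + μ) • dirichletResolvent Ω u = u ↔
      ∃ p ∈ H10 Ω, p.fst = u ∧ ∀ q ∈ H10 Ω, ⟪p.snd, q.snd⟫ = μ * ⟪p.fst, q.fst⟫ := by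
  have inner_smul_adjoint (q : H10 Ω) :
      ⟪(1 + μ) • (H10.embed Ω).adjoint u, q⟫ = (1 + μ) * ⟪u, q.1.fst⟫ :=
    (real_inner_smul_left _ _ _).trans (congrArg _ (inner_adjoint_embed u q))
  have inner_H10 (p q : H10 Ω) : ⟪p, q⟫ = ⟪p.1.fst, q.1.fst⟫ + ⟪p.1.snd, q.1.snd⟫ := rfl
  constructor
  · intro hu
    refine ⟨_, ((1 + μ) • (H10.embed Ω).adjoint u).2, hu, fun q hq => ?_⟩
    have h := inner_smul_adjoint ⟨q, hq⟩
    have hfst : ((1 + μ) • (H10.embed Ω).adjoint u).1.fst = u := hu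
    rw [inner_H10, hfst] at h
    rw [hfst]
    linarith
  · rintro ⟨p, hp, rfl, hpq⟩
    have h : (1 + μ) • (H10.embed Ω).adjoint p.fst = ⟨p, hp⟩ := by
      refine ext_inner_right ℝ fun q => ?_
      rw [inner_smul_adjoint, inner_H10, hpq q.1 q.2]
      ring
    exact congrArg (H10.embed Ω) h

theorem isDirichletEigenfunction_iff (hd : 0 < d) (hb : Bornology.IsBounded Ω) {μ : ℝ}
    {u : L2 Ω} :
    IsDirichletEigenfunction Ω μ u ↔ u ≠ 0 ∧ (1 + μ) • dirichletResolvent Ω u = u := by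
  rw [one_add_smul_dirichletResolvent_eq_self_iff]
  refine ⟨fun h => ⟨h.1, h.2.2⟩, ?_⟩
  rintro ⟨hu, p, hp, rfl, hpq⟩
  refine ⟨hu, ?_, p, hp, rfl, hpq⟩
  obtain ⟨C, hC⟩ := exists_norm_fst_le_norm_snd_of_mem_H10 hd hb
  have hsnd : p.snd ≠ 0 := fun h => hu (norm_le_zero_iff.1 (by simpa [h] using hC p hp))
  have hμ := hpq p hp
  rw [real_inner_self_eq_norm_sq, real_inner_self_eq_norm_sq] at hμ
  exact pos_of_mul_pos_left (hμ ▸ pow_pos (norm_pos_iff.2 hsnd) 2) (sq_nonneg ‖p.fst‖)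

variable {ι : Type} (S : DirichletEigensystem Ω ι)

theorem DirichletEigensystem.orthogonal_span_range_fn (hd : 0 < d) (hΩ : IsOpen Ω)
    (hb : Bornology.IsBounded Ω) : (Submodule.span ℝ (range S.fn))ᗮ = ⊥ := by
  refine orthogonal_span_range_eq_bot_of_maximal (κ := fun n => (1 + S.ev n)⁻¹)
    (isCompactOperator_dirichletResolvent hb) (isSymmetric_dirichletResolvent Ω)
    (fun n => ?_) fun v hv c hc => ?_
  · have hpos : 0 < 1 + S.ev n := by linarith [(S.eigen n).2.1]
    rw [eq_inv_smul_iff₀ hpos.ne']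
    exact ((isDirichletEigenfunction_iff hd hb).1 (S.eigen n)).2
  · have hc₀ : c ≠ 0 := by
      rintro rfl
      exact hv ((Submodule.eq_bot_iff _).1 (ker_dirichletResolvent hΩ) v (by simpa using hc))
    refine S.maximal (c⁻¹ - 1) v ((isDirichletEigenfunction_iff hd hb).2 ⟨hv, ?_⟩)
    rw [hc, add_sub_cancel, inv_smul_smul₀ hc₀]

theorem DirichletEigensystem.hasSum (hd : 0 < d) (hΩ : IsOpen Ω) (hb : Bornology.IsBounded Ω)
    (u : L2 Ω) : HasSum (fun n => ⟪S.fn n, u⟫ • S.fn n) u := by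
  let b := HilbertBasis.mkOfOrthogonalEqBot S.orthonormal (S.orthogonal_span_range_fn hd hΩ hb)
  have hbn : ∀ n, b n = S.fn n := fun n => by simp [b]
  simpa only [HilbertBasis.repr_apply_apply, hbn] using b.hasSum_repr u

end DirichletResolvent

/-! ### Multiplication by test functions in the spectral space -/

section RpowIntegral

variable {ι : Type*} {s : ℝ} {l : ι → ℝ}

theorem rpow_mul_sum_div_add (hs : s ∈ Ioo (0 : ℝ) 1) (hl : ∀ n, 0 ≤ l n) (G : Finset ι)
    (x : ι → ℝ) {t : ℝ} (ht : 0 ≤ t) :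
    t ^ (s - 1) * ∑ n ∈ G, l n / (t + l n) * x n =
      ∑ n ∈ G, Real.rpowIntegrand₀₁ s t (l n) * x n := by
  rw [Finset.mul_sum]
  refine Finset.sum_congr rfl fun n _ => ?_
  rw [Real.rpowIntegrand₀₁_eq_pow_div hs ht (hl n)]
  ring

theorem integrableOn_rpow_mul_sum_div_add (hs : s ∈ Ioo (0 : ℝ) 1) (hl : ∀ n, 0 ≤ l n)
    (G : Finset ι) (x : ι → ℝ) :
    IntegrableOn (fun t => t ^ (s - 1) * ∑ n ∈ G, l n / (t + l n) * x n) (Ioi 0) := by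
  rw [integrableOn_congr_fun (fun t ht => rpow_mul_sum_div_add hs hl G x (mem_Ioi.1 ht).le)
    measurableSet_Ioi]
  exact integrable_finsetSum _ fun n _ =>
    (Real.integrableOn_rpowIntegrand₀₁_Ioi hs (hl n)).mul_const _

theorem integral_rpow_mul_sum_div_add (hs : s ∈ Ioo (0 : ℝ) 1) (hl : ∀ n, 0 ≤ l n)
    (G : Finset ι) (x : ι → ℝ) :
    ∫ t in Ioi 0, t ^ (s - 1) * ∑ n ∈ G, l n / (t + l n) * x n =
      (∑ n ∈ G, l n ^ s * x n) * ∫ t in Ioi 0, Real.rpowIntegrand₀₁ s t 1 := by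
  rw [setIntegral_congr_fun measurableSet_Ioi fun t ht =>
      rpow_mul_sum_div_add hs hl G x (mem_Ioi.1 ht).le,
    integral_finsetSum _ fun n _ =>
      (Real.integrableOn_rpowIntegrand₀₁_Ioi hs (hl n)).mul_const _, Finset.sum_mul]
  refine Finset.sum_congr rfl fun n _ => ?_
  rw [integral_mul_const, Real.integral_rpowIntegrand₀₁_eq_rpow_mul_const hs (hl n)]
  ring

theorem sum_rpow_mul_le_of_forall_sum_div_add_mul_le (hs : s ∈ Ioo (0 : ℝ) 1)
    (hl : ∀ n, 0 ≤ l n) {G N : Finset ι} {x y : ι → ℝ}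
    (h : ∀ t > 0, ∑ n ∈ G, l n / (t + l n) * x n ≤ ∑ n ∈ N, l n / (t + l n) * y n) :
    ∑ n ∈ G, l n ^ s * x n ≤ ∑ n ∈ N, l n ^ s * y n := by
  have hle := setIntegral_mono_on (integrableOn_rpow_mul_sum_div_add hs hl G x)
    (integrableOn_rpow_mul_sum_div_add hs hl N y) measurableSet_Ioi
    fun t ht => mul_le_mul_of_nonneg_left (h t ht) (Real.rpow_nonneg (le_of_lt ht) _)
  rw [integral_rpow_mul_sum_div_add hs hl, integral_rpow_mul_sum_div_add hs hl] at hle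
  exact le_of_mul_le_mul_right hle (Real.integral_rpowIntegrand₀₁_one_pos hs)

end RpowIntegral

namespace DirichletEigensystem

variable {d : ℕ} {Ω : Set (E d)} {ι : Type} (S : DirichletEigensystem Ω ι)

theorem norm_sum_smul_fn_sq (N : Finset ι) (a : ι → ℝ) :
    ‖∑ n ∈ N, a n • S.fn n‖ ^ 2 = ∑ n ∈ N, a n ^ 2 := by
  rw [← real_inner_self_eq_norm_sq, S.orthonormal.inner_sum]
  simp [sq]

theorem exists_mem_H10_fst_eq_sum (N : Finset ι) (a : ι → ℝ) :
    ∃ p ∈ H10 Ω, p.fst = ∑ n ∈ N, a n • S.fn n ∧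
      (∀ q ∈ H10 Ω, ⟪p.snd, q.snd⟫ = ∑ n ∈ N, S.ev n * (a n * ⟪S.fn n, q.fst⟫)) ∧
      ‖p.snd‖ ^ 2 = ∑ n ∈ N, S.ev n * a n ^ 2 := by
  choose e he hfst hinner using fun n => (S.eigen n).2.2
  set p := ∑ n ∈ N, a n • e n
  have hp : p ∈ H10 Ω := Submodule.sum_mem _ fun n _ => Submodule.smul_mem _ _ (he n)
  have hpfst : p.fst = ∑ n ∈ N, a n • S.fn n :=
    (map_sum (WithLp.fstL 2 ℝ (L2 Ω) (L2Vec Ω)) (fun n => a n • e n) N).trans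
      (Finset.sum_congr rfl fun n _ => congrArg (a n • ·) (hfst n))
  have hpsnd : p.snd = ∑ n ∈ N, a n • (e n).snd :=
    map_sum (WithLp.sndL 2 ℝ (L2 Ω) (L2Vec Ω)) (fun n => a n • e n) N
  have hpinner (q) (hq : q ∈ H10 Ω) :
      ⟪p.snd, q.snd⟫ = ∑ n ∈ N, S.ev n * (a n * ⟪S.fn n, q.fst⟫) := by
    rw [hpsnd, sum_inner]
    refine Finset.sum_congr rfl fun n _ => ?_
    rw [real_inner_smul_left, hinner n q hq, hfst, mul_left_comm]
  refine ⟨p, hp, hpfst, hpinner, ?_⟩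
  rw [← real_inner_self_eq_norm_sq, hpinner p hp]
  refine Finset.sum_congr rfl fun n hn => ?_
  rw [hpfst, S.orthonormal.inner_right_sum a hn, sq]

theorem sum_ev_mul_inner_sq_le {p : WithLp 2 (L2 Ω × L2Vec Ω)} (hp : p ∈ H10 Ω) (G : Finset ι) :
    ∑ n ∈ G, S.ev n * ⟪S.fn n, p.fst⟫ ^ 2 ≤ ‖p.snd‖ ^ 2 := by
  obtain ⟨q, -, -, hq, hqnorm⟩ := S.exists_mem_H10_fst_eq_sum G fun n => ⟪S.fn n, p.fst⟫
  have hqp : ⟪q.snd, p.snd⟫ = ∑ n ∈ G, S.ev n * ⟪S.fn n, p.fst⟫ ^ 2 := by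
    simp only [hq p hp, sq]
  have hsub := norm_sub_sq_real q.snd p.snd
  rw [hqp, hqnorm] at hsub
  linarith [sq_nonneg ‖q.snd - p.snd‖]

-- As `G` exhausts all indices, the left side tends to the minimum of the right side over all
-- decompositions of a fixed `u` as `p.fst + b`.
theorem mul_sum_div_add_mul_inner_sq_le {p : WithLp 2 (L2 Ω × L2Vec Ω)} (hp : p ∈ H10 Ω)
    (b : L2 Ω) (G : Finset ι) {t : ℝ} (ht : 0 < t) :
    t * ∑ n ∈ G, S.ev n / (t + S.ev n) * ⟪S.fn n, p.fst + b⟫ ^ 2 ≤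
      ‖p.snd‖ ^ 2 + t * ‖b‖ ^ 2 := by
  have hb : ∑ n ∈ G, ⟪S.fn n, b⟫ ^ 2 ≤ ‖b‖ ^ 2 := by
    simpa using S.orthonormal.sum_inner_products_le (s := G) b
  refine le_trans ?_ (add_le_add (S.sum_ev_mul_inner_sq_le hp G)
    (mul_le_mul_of_nonneg_left hb ht.le))
  rw [Finset.mul_sum, Finset.mul_sum, ← Finset.sum_add_distrib]
  refine Finset.sum_le_sum fun n _ => ?_
  have hev := (S.eigen n).2.1
  rw [inner_add_right, ← mul_assoc, mul_div_assoc', div_mul_eq_mul_div,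
    div_le_iff₀ (by positivity)]
  linarith [sq_nonneg (S.ev n * ⟪S.fn n, p.fst⟫ - t * ⟪S.fn n, b⟫)]

theorem exists_fst_add_eq_sum (N : Finset ι) (c : ι → ℝ) {t : ℝ} (ht : 0 < t) :
    ∃ p ∈ H10 Ω, ∃ b : L2 Ω, p.fst + b = ∑ n ∈ N, c n • S.fn n ∧
      ‖p.snd‖ ^ 2 + t * ‖b‖ ^ 2 = t * ∑ n ∈ N, S.ev n / (t + S.ev n) * c n ^ 2 := by
  have hpos (n) : t + S.ev n ≠ 0 := (add_pos ht (S.eigen n).2.1).ne'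
  obtain ⟨p, hp, hfst, -, hsnd⟩ := S.exists_mem_H10_fst_eq_sum N fun n => t / (t + S.ev n) * c n
  refine ⟨p, hp, ∑ n ∈ N, (S.ev n / (t + S.ev n) * c n) • S.fn n, ?_, ?_⟩
  · rw [hfst, ← Finset.sum_add_distrib]
    refine Finset.sum_congr rfl fun n _ => ?_
    rw [← add_smul, ← add_mul, ← add_div, div_self (hpos n), one_mul]
  · rw [hsnd, S.norm_sum_smul_fn_sq, Finset.mul_sum, Finset.mul_sum, ← Finset.sum_add_distrib]
    refine Finset.sum_congr rfl fun n _ => ?_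
    have := hpos n
    field_simp

section Interpolation

variable {A : L2 Ω →L[ℝ] L2 Ω} {K : ℝ}
  (hA : ∀ p ∈ H10 Ω, ∃ q ∈ H10 Ω, q.fst = A p.fst ∧ ‖q.snd‖ ≤ K * ‖p.snd‖)
include hA

theorem sum_div_add_mul_inner_map_sq_le (G N : Finset ι) (c : ι → ℝ) {t : ℝ} (ht : 0 < t) :
    ∑ n ∈ G, S.ev n / (t + S.ev n) * ⟪S.fn n, A (∑ n ∈ N, c n • S.fn n)⟫ ^ 2 ≤
      max K ‖A‖ ^ 2 * ∑ n ∈ N, S.ev n / (t + S.ev n) * c n ^ 2 := by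
  obtain ⟨p, hp, b, hpb, henergy⟩ := S.exists_fst_add_eq_sum N c ht
  obtain ⟨q, hq, hqp, hqK⟩ := hA p hp
  have hsnd : ‖q.snd‖ ≤ max K ‖A‖ * ‖p.snd‖ := hqK.trans (by gcongr; exact le_max_left _ _)
  have hb : ‖A b‖ ≤ max K ‖A‖ * ‖b‖ := (A.le_opNorm b).trans (by gcongr; exact le_max_right _ _)
  refine le_of_mul_le_mul_left ?_ ht
  calc t * ∑ n ∈ G, S.ev n / (t + S.ev n) * ⟪S.fn n, A (∑ n ∈ N, c n • S.fn n)⟫ ^ 2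
      = t * ∑ n ∈ G, S.ev n / (t + S.ev n) * ⟪S.fn n, q.fst + A b⟫ ^ 2 := by
        rw [← hpb, map_add, hqp]
    _ ≤ ‖q.snd‖ ^ 2 + t * ‖A b‖ ^ 2 := S.mul_sum_div_add_mul_inner_sq_le hq (A b) G ht
    _ ≤ (max K ‖A‖ * ‖p.snd‖) ^ 2 + t * (max K ‖A‖ * ‖b‖) ^ 2 := by gcongr
    _ = max K ‖A‖ ^ 2 * (‖p.snd‖ ^ 2 + t * ‖b‖ ^ 2) := by ring
    _ = t * (max K ‖A‖ ^ 2 * ∑ n ∈ N, S.ev n / (t + S.ev n) * c n ^ 2) := by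
        rw [henergy, mul_left_comm]

theorem sum_ev_rpow_mul_inner_map_sq_le {s : ℝ} (hs : s ∈ Ioo (0 : ℝ) 1) (G N : Finset ι)
    (c : ι → ℝ) :
    ∑ n ∈ G, S.ev n ^ s * ⟪S.fn n, A (∑ n ∈ N, c n • S.fn n)⟫ ^ 2 ≤
      max K ‖A‖ ^ 2 * ∑ n ∈ N, S.ev n ^ s * c n ^ 2 := by
  simp only [Finset.mul_sum, mul_left_comm (max K ‖A‖ ^ 2)]
  refine sum_rpow_mul_le_of_forall_sum_div_add_mul_le hs (fun n => (S.eigen n).2.1.le)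
    fun t ht => (S.sum_div_add_mul_inner_map_sq_le hA G N c ht).trans_eq ?_
  simp only [Finset.mul_sum, mul_left_comm (max K ‖A‖ ^ 2)]

theorem map_mem_specSubmodule (hd : 0 < d) (hΩ : IsOpen Ω) (hb : Bornology.IsBounded Ω) {s : ℝ}
    (hs : s ∈ Ioo (0 : ℝ) 1) {w : L2 Ω} (hw : w ∈ specSubmodule S s) :
    A w ∈ specSubmodule S s := by
  have hnonneg (n) (x : ℝ) : 0 ≤ S.ev n ^ s * x ^ 2 :=
    mul_nonneg (Real.rpow_nonneg (S.eigen n).2.1.le s) (sq_nonneg x)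
  have hpartial (G N : Finset ι) := (S.sum_ev_rpow_mul_inner_map_sq_le hA hs G N
    fun n => ⟪S.fn n, w⟫).trans (mul_le_mul_of_nonneg_left
      (hw.2.sum_le_tsum N fun n _ => hnonneg n _) (sq_nonneg _))
  have hlim (G : Finset ι) : Tendsto
      (fun N : Finset ι => ∑ n ∈ G, S.ev n ^ s * ⟪S.fn n, A (∑ n ∈ N, ⟪S.fn n, w⟫ • S.fn n)⟫ ^ 2)
      atTop (𝓝 (∑ n ∈ G, S.ev n ^ s * ⟪S.fn n, A w⟫ ^ 2)) :=
    tendsto_finsetSum _ fun n _ =>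
      ((tendsto_const_nhds.inner ((A.continuous.tendsto w).comp hw.1)).pow 2).const_mul _
  exact ⟨S.hasSum hd hΩ hb _, summable_of_sum_le (fun n => hnonneg n _) fun G =>
    le_of_tendsto' (hlim G) (hpartial G)⟩

end Interpolation

end DirichletEigensystem

theorem exists_mul_specSubmodule {d : ℕ} (hd : 0 < d) {Ω : Set (E d)} (hΩ : IsOpen Ω)
    (hb : Bornology.IsBounded Ω) {s : ℝ} (hs : s ∈ Ioo (0 : ℝ) 1) {ι : Type}
    (S : DirichletEigensystem Ω ι) {φ : E d → ℝ} (hφ : IsTestFunction Ω φ) {w : L2 Ω}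
    (hw : w ∈ specSubmodule S s) :
    ∃ v ∈ specSubmodule S s, v =ᵐ[volume.restrict Ω] fun x => φ x * w x := by
  obtain ⟨K, hK⟩ := exists_mul_mem_H10 hd hb hφ
  exact ⟨_, S.map_mem_specSubmodule hK hd hΩ hb hs hw, coeFn_mulLp _ _ w⟩

/-! ### First-order conditions -/

theorem coeFn_add_smul {α : Type*} [MeasurableSpace α] {μ : Measure α} (f g : Lp ℝ 2 μ) (t : ℝ) :
    ⇑(f + t • g) =ᵐ[μ] fun x => f x + t * g x := by
  filter_upwards [Lp.coeFn_add f (t • g), Lp.coeFn_smul t g] with x hadd hsmul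
  rw [hadd, Pi.add_apply, hsmul, Pi.smul_apply, smul_eq_mul]

namespace W

variable {d : ℕ} {Ω : Set (E d)} {s : ℝ} {k : InnerChoice Ω}

theorem toFun_add_smul (w v : W s k) (t : ℝ) :
    ∀ᵐ x ∂volume.restrict Ω, (w + t • v).toFun x = w.toFun x + t * v.toFun x := by
  match k, w, v with
  | .integral, (w : H0s Ω s), (v : H0s Ω s) => exact coeFn_add_smul w.1.1.fst v.1.1.fst t
  | .global, (w : HTilde Ω s), (v : HTilde Ω s) =>
    exact ae_restrict_of_ae_restrict_of_subset (subset_univ Ω)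
      (coeFn_add_smul w.1.1.fst v.1.1.fst t)
  | .spectral _ S, w, v => exact coeFn_add_smul (HSpec.toL2 S s w) (HSpec.toL2 S s v) t

theorem exists_mul_testFunction (hd : 0 < d) (hΩ : IsOpen Ω) (hb : Bornology.IsBounded Ω)
    (hs : s ∈ Ioo (0 : ℝ) 1) {φ : E d → ℝ} (hφ : IsTestFunction Ω φ) (w : W s k) :
    ∃ v : W s k, ∀ᵐ x ∂volume.restrict Ω, v.toFun x = φ x * w.toFun x := by
  match k, w with
  | .integral, w => exact exists_mul_H0s hd hs hφ w
  | .global, w =>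
    obtain ⟨C, hC⟩ := hφ.exists_bound
    obtain ⟨L, hL⟩ := hφ.exists_lipschitzWith
    obtain ⟨v, hv⟩ := exists_mul_HTilde hd hs hC hL w
    exact ⟨v, ae_restrict_of_ae_restrict_of_subset (subset_univ Ω) hv⟩
  | .spectral _ S, w =>
    obtain ⟨v, hv, hvw⟩ := exists_mul_specSubmodule hd hΩ hb hs S hφ w.2
    exact ⟨⟨v, hv⟩, hvw⟩

end W

theorem absPowZero_mul_of_ne_zero {a : ℝ} (ha : a ≠ 0) (t : ℝ) :
    absPowZero (a * t) = absPowZero t := by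
  simp only [absPowZero, mul_eq_zero, ha, false_or]

section FirstOrder

variable {d : ℕ} {Ω : Set (E d)} {s : ℝ} {k : InnerChoice Ω} {w v : W s k} {g : E d → ℝ} {C : ℝ}

theorem eventually_setIntegral_absPowZero_add_smul_eq (hg : ∀ x, ‖g x‖ ≤ C)
    (hv : ∀ᵐ x ∂volume.restrict Ω, v.toFun x = g x * w.toFun x) :
    ∀ᶠ t : ℝ in 𝓝 0,
      ∫ x in Ω, absPowZero ((w + t • v).toFun x) = ∫ x in Ω, absPowZero (w.toFun x) := by
  have hsmall : ∀ᶠ t : ℝ in 𝓝 0, |t| * C < 1 :=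
    (continuous_abs.mul continuous_const).continuousAt.eventually_lt_const (by simp)
  filter_upwards [hsmall] with t ht
  refine integral_congr_ae ?_
  filter_upwards [W.toFun_add_smul w v t, hv] with x hadd hvx
  have hlt : |t * g x| < 1 := by
    rw [abs_mul]
    exact (mul_le_mul_of_nonneg_left (hg x) (abs_nonneg t)).trans_lt ht
  have hne : 1 + t * g x ≠ 0 := by linarith [(abs_lt.1 hlt).1]
  rw [hadd, hvx, ← absPowZero_mul_of_ne_zero hne (w.toFun x)]
  congr 1
  ring

theorem hasDerivAt_add_sq_norm_add_smul {V : Type*} [NormedAddCommGroup V]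
    [InnerProductSpace ℝ V] {F : V → ℝ} {w : V} (hF : DifferentiableAt ℝ F w) (α : ℝ) (v : V) :
    HasDerivAt (fun t : ℝ => F (w + t • v) + α / 2 * ‖w + t • v‖ ^ 2)
      (fderiv ℝ F w v + α * ⟪w, v⟫) 0 := by
  have hline : HasDerivAt (fun t : ℝ => w + t • v) v 0 := by
    simpa using ((hasDerivAt_id (0 : ℝ)).smul_const v).const_add w
  have hF' : HasFDerivAt F (fderiv ℝ F w) (w + (0 : ℝ) • v) := by simpa using hF.hasFDerivAt
  refine ((hF'.comp_hasDerivAt (0 : ℝ) hline).add (hline.norm_sq.const_mul (α / 2))).congr_deriv ?_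
  rw [zero_smul, add_zero]
  ring

theorem IsMultiplier.apply_eq_zero {F : W s k → ℝ} {α β : ℝ} (hβ : β ≠ 0)
    (hF : DifferentiableAt ℝ F w) (hw : IsLocalMin (objective F α β) w) {lam : W s k →L[ℝ] ℝ}
    (hlam : IsMultiplier F α β w lam) (hg : ∀ x, ‖g x‖ ≤ C)
    (hv : ∀ᵐ x ∂volume.restrict Ω, v.toFun x = g x * w.toFun x) : lam v = 0 := by
  have hline : Tendsto (fun t : ℝ => w + t • v) (𝓝 0) (𝓝 w) :=
    Continuous.tendsto' (by fun_prop) _ _ (by simp)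
  have hmin : IsLocalMin (fun t : ℝ => F (w + t • v) + α / 2 * ‖w + t • v‖ ^ 2) 0 := by
    filter_upwards [hline.eventually hw, eventually_setIntegral_absPowZero_add_smul_eq hg hv]
      with t hle hsupp
    rw [objective, objective, hsupp] at hle
    simpa using hle
  have hstationary := hmin.hasDerivAt_eq_zero (hasDerivAt_add_sq_norm_add_smul hF α v)
  have heq := hlam v
  rw [hstationary, zero_add] at heq
  exact (mul_eq_zero.1 heq).resolve_left hβ

end FirstOrder

theorem existsUnique_isMultiplier {V : Type} [NormedAddCommGroup V] [InnerProductSpace ℝ V]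
    (F : V → ℝ) (α : ℝ) {β : ℝ} (hβ : β ≠ 0) (w : V) :
    ∃! lam : V →L[ℝ] ℝ, IsMultiplier F α β w lam := by
  refine ⟨-(β⁻¹ • (fderiv ℝ F w + α • innerSL ℝ w)), fun v => ?_, fun lam hlam => ?_⟩
  · simp only [neg_apply, smul_apply, add_apply, innerSL_apply_apply, smul_eq_mul]
    field_simp
    ring
  · ext v
    have h := hlam v
    simp only [neg_apply, smul_apply, add_apply, innerSL_apply_apply, smul_eq_mul]
    field_simp
    linarith

end FracSob

end

theorem mainTheorem8_general {d : ℕ} (hd : 0 < d) {Ω : Set (FracSob.E d)} (hΩ : IsOpen Ω)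
    (hb : Bornology.IsBounded Ω) {s : ℝ} (hs : s ∈ Ioo (0 : ℝ) 1) (k : FracSob.InnerChoice Ω)
    (F : FracSob.W s k → ℝ) (α : ℝ) {β : ℝ} (hβ : β ≠ 0) (w₀ : FracSob.W s k)
    (hF : DifferentiableAt ℝ F w₀) (hw₀ : IsLocalMin (FracSob.objective F α β) w₀) :
    (∃! lam : FracSob.W s k →L[ℝ] ℝ, FracSob.IsMultiplier F α β w₀ lam) ∧
    ∀ lam : FracSob.W s k →L[ℝ] ℝ, FracSob.IsMultiplier F α β w₀ lam →
      lam w₀ = 0 ∧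
      ∀ φ : FracSob.E d → ℝ, FracSob.IsTestFunction Ω φ →
        ∃ v : FracSob.W s k,
          (∀ᵐ x ∂volume.restrict Ω, v.toFun x = φ x * w₀.toFun x) ∧ lam v = 0 := by
  refine ⟨FracSob.existsUnique_isMultiplier F α hβ w₀, fun lam hlam => ⟨?_, fun φ hφ => ?_⟩⟩
  · exact hlam.apply_eq_zero hβ hF hw₀ (g := fun _ => 1) (fun _ => norm_one.le)
      (Eventually.of_forall fun _ => (one_mul _).symm)
  · obtain ⟨v, hv⟩ := FracSob.W.exists_mul_testFunction hd hΩ hb hs hφ w₀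
    obtain ⟨C, hC⟩ := hφ.exists_bound
    exact ⟨v, hv, hlam.apply_eq_zero hβ hF hw₀ hC hv⟩

theorem mainTheorem8 {d : ℕ} (hd : 0 < d) {Ω : Set (FracSob.E d)}
    (hΩ : FracSob.IsBoundedLipschitzDomain Ω)
    {s : ℝ} (hs : s ∈ Set.Ioo (0 : ℝ) 1) (hs' : s ≠ 1 / 2)
    (k : FracSob.InnerChoice Ω)
    (F : FracSob.W s k → ℝ) (hF : FracSob.Admissible F)
    {α β : ℝ} (hα : 0 < α) (hβ : 0 < β)
    (w₀ : FracSob.W s k) (hw₀ : IsLocalMin (FracSob.objective F α β) w₀) :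
    (∃! lam : FracSob.W s k →L[ℝ] ℝ, FracSob.IsMultiplier F α β w₀ lam) ∧
    ∀ lam : FracSob.W s k →L[ℝ] ℝ, FracSob.IsMultiplier F α β w₀ lam →
      0 ≤ lam w₀ ∧
      ∀ φ : FracSob.E d → ℝ, FracSob.IsTestFunction Ω φ → (∀ x, 0 ≤ φ x) →
        ∃ v : FracSob.W s k,
          (∀ᵐ x ∂(MeasureTheory.volume.restrict Ω), v.toFun x = φ x * w₀.toFun x) ∧
          0 ≤ lam v := by
  obtain ⟨hex, hsign⟩ := mainTheorem8_general hd hΩ.isOpen hΩ.isBounded hs k F α hβ.ne' w₀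
    (hF.contDiff.differentiable one_ne_zero w₀) hw₀
  refine ⟨hex, fun lam hlam => ⟨(hsign lam hlam).1.ge, fun φ hφ _ => ?_⟩⟩
  obtain ⟨v, hv, hzero⟩ := (hsign lam hlam).2 φ hφ
  exact ⟨v, hv, hzero.ge⟩
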